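/- Let $\alpha>0$, $\beta\in\mathbb R$, $\nu>0$. For $\xi>0$ let $X(t)$, $t\ge 0$, be the Ornstein–Uhlenbeck jump-diffusion on $\mathbb R$ with drift $-\alpha(x-\beta)$, infinitesimal variance $\alpha\nu$, and resetting to $0$ at constant rate $\xi$; that is, a càdlàg solution of the martingale problem, on smooth compactly supported functions $\varphi$, for $$L\varphi(x)=-\alpha(x-\beta)\varphi'(x)+\tfrac{\alpha\nu}{2}\varphi''(x)+\xi\,(\varphi(0)-\varphi(x)).$$ Let $\widetilde X(t)$ be the same process with $\xi=0$ (no resetting). For $t>0$ let $f(x,t\,|\,y)=\partial_x P\{X(t)\le x\mid X(0)=y\}$ and $\widetilde f(x,t\,|\,y)=\partial_xP\{\widetilde X(t)\le x\mid\widetilde X(0)=y\}$ be the transition densities. 1. $\widetilde f(\cdot,t\,|\,y)$ exists for $t>0$ and is the normal density with mean $\beta(1-e^{-\alpha t})+ye^{-\alpha t}$ and variance $\frac{\nu}{2}(1-e^{-2\alpha t})$; for all $x,y\in\mathbb R$ it tends, as $t\to+\infty$, to $$\widetilde W(x)=\frac1{\sqrt{\pi\nu}}\exp\Bigl\{-\frac{(x-\beta)^2}{\nu}\Bigr\}.$$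 2. For every $\xi>0$ the density $f(x,t\,|\,y)$ exists for all $t>0$ and $x,y\in\mathbb R$, and the steady-state density of $X$ is $$W(x)=\lim_{t\to+\infty}f(x,t\,|\,y)=\xi\,\widetilde f_\xi(x\,|\,0),\qquad \widetilde f_s(x\,|\,y)=\int_0^{+\infty}e^{-st}\widetilde f(x,t\,|\,y)\,dt,$$ for all $x,y\in\mathbb R$, where the integral converges absolutely for $s=\xi$, $y=0$. $W$ is a probability density. 3. For all $x\in\mathbb R$, with $\sigma=1$ if $x>0$, $\sigma=-1$ if $x<0$, and either choice $\sigma=\pm1$ if $x=0$, $$W(x)=\frac{2^{\xi/\alpha}}{\pi\sqrt\nu}\,\Gamma\Bigl(1+\frac{\xi}{2\alpha}\Bigr)\Gamma\Bigl(\frac12+\frac{\xi}{2\alpha}\Bigr)\exp\Bigl\{-\frac{x(x-2\beta)}{2\nu}\Bigr\}\,D_{-\xi/\alpha}\Bigl(\sigma\beta\sqrt{\tfrac2\nu}\Bigr)\,D_{-\xi/\alpha}\Bigl(\sigma(x-\beta)\sqrt{\tfrac2\nu}\Bigr),$$ where $D_p$ is the parabolic cylinder function $$D_p(z)=2^{p/2}e^{-z^2/4}\Bigl\{\frac{\sqrt\pi}{\Gamma(\frac{1-p}2)}\,\phi\Bigl(-\frac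 p2,\frac12;\frac{z^2}2\Bigr)-\frac{\sqrt{2\pi}\,z}{\Gamma(-\frac p2)}\,\phi\Bigl(\frac{1-p}2,\frac32;\frac{z^2}2\Bigr)\Bigr\},\qquad \phi(a,c;x)=\sum_{n\ge0}\frac{(a)_n}{(c)_n}\frac{x^n}{n!},$$ and $(a)_n=a(a+1)\cdots(a+n-1)$, $(a)_0=1$. 4. Writing $W(x;\beta)$ for $W(x)$ to show the dependence on $\beta$, $W(x;\beta)=W(-x;-\beta)$ for all $x,\beta\in\mathbb R$. 5. $\lim_{\xi\to0^+}W(x)=\widetilde W(x)$ for all $x\in\mathbb R$. -/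

import Mathlib

open MeasureTheory ProbabilityTheory Filter Topology Set
open scoped NNReal

noncomputable section

/-- The infinitesimal generator of the Ornstein-Uhlenbeck jump-diffusion: drift `-α (x - β)`,
infinitesimal variance `α ν`, and jumps from `x` to `0` with rate `ξ`.  For `ξ = 0` it is the
generator of the Ornstein-Uhlenbeck diffusion. -/
def resetGenerator (α β ν ξ : ℝ) (φ : ℝ → ℝ) (x : ℝ) : ℝ :=
  -α * (x - β) * deriv φ x + (1 / 2) * (α * ν) * deriv (deriv φ) x + ξ * (φ 0 - φ x)

/-- `X` is, under the probability measure `P`, an Ornstein-Uhlenbeck process on `ℝ` with resetting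
to `0` at rate `ξ`, started at `y`: a càdlàg process that solves the martingale problem for
`resetGenerator α β ν ξ` on the smooth compactly supported functions.  With `ξ = 0` this is the
Ornstein-Uhlenbeck process without resetting. -/
structure IsResetOU {Ω : Type*} [mΩ : MeasurableSpace Ω] (α β ν ξ y : ℝ)
    (P : Measure Ω) (ℱ : Filtration ℝ≥0 mΩ) (X : ℝ≥0 → Ω → ℝ) : Prop where
  adapted : ∀ t, Measurable[ℱ t] (X t)
  right_continuous : ∀ ω t, ContinuousWithinAt (fun s => X s ω) (Ici t) t
  left_limits : ∀ ω t, ∃ l, Tendsto (fun s => X s ω) (𝓝[<] t) (𝓝 l)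
  initial : ∀ᵐ ω ∂P, X 0 ω = y
  martingale : ∀ φ : ℝ → ℝ, ContDiff ℝ (⊤ : ℕ∞) φ → HasCompactSupport φ →
    Martingale (fun (t : ℝ≥0) ω => φ (X t ω) - φ (X 0 ω)
      - ∫ s in (0 : ℝ)..t, resetGenerator α β ν ξ φ (X s.toNNReal ω)) ℱ P

/-- The distribution function `x ↦ P (X t ≤ x)`. -/
def distFun {Ω : Type*} [MeasurableSpace Ω] (P : Measure Ω) (X : ℝ≥0 → Ω → ℝ)
    (t : ℝ≥0) (x : ℝ) : ℝ :=
  P.real {ω | X t ω ≤ x}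

/-- The transition density `f (x, t | y) = ∂/∂x P (X t ≤ x)` of a process started at `y` under
`P`. -/
def transitionDensity {Ω : Type*} [MeasurableSpace Ω] (P : Measure Ω) (X : ℝ≥0 → Ω → ℝ)
    (x : ℝ) (t : ℝ≥0) : ℝ :=
  deriv (distFun P X t) x

/-- The transition density `f̃ (x, t | y)` of the Ornstein-Uhlenbeck process (for `t > 0`): normal
with mean `β (1 - e^(-α t)) + y e^(-α t)` and variance `(ν / 2) (1 - e^(-2 α t))`. -/
def ouDensity (α β ν x t y : ℝ) : ℝ :=
  gaussianPDFReal (β * (1 - Real.exp (-α * t)) + y * Real.exp (-α * t))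
    (ν / 2 * (1 - Real.exp (-2 * α * t))).toNNReal x

/-- The Laplace transform `f̃_s (x | y)` in time of the Ornstein-Uhlenbeck transition density. -/
def ouLaplace (α β ν s x y : ℝ) : ℝ :=
  ∫ t in Ioi (0 : ℝ), Real.exp (-s * t) * ouDensity α β ν x t y

/-- `W (x) = ξ f̃_ξ (x | 0)`. -/
def steadyDensity (α β ν ξ x : ℝ) : ℝ := ξ * ouLaplace α β ν ξ x 0

/-- `W̃ (x)`, the normal density with mean `β` and variance `ν / 2`. -/
def ouSteadyDensity (β ν x : ℝ) : ℝ :=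
  1 / Real.sqrt (Real.pi * ν) * Real.exp (-(x - β) ^ 2 / ν)

/-- The Kummer function `φ (a, c; x) = ∑ n, (a)_n / (c)_n * x ^ n / n!`, with rising factorials. -/
def kummer (a c x : ℝ) : ℝ :=
  ∑' n : ℕ, (ascPochhammer ℝ n).eval a / (ascPochhammer ℝ n).eval c * (x ^ n / (n.factorial : ℝ))

/-- The parabolic cylinder function `D_p (z)` for real `p` and `z`.  At the poles of `Γ` the
quotients by `Γ` are `0`, as they should be, because there `Real.Gamma` is `0`. -/
def parabolicCylinder (p z : ℝ) : ℝ :=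
  (2 : ℝ) ^ (p / 2) * Real.exp (-z ^ 2 / 4) *
    (Real.sqrt Real.pi / Real.Gamma ((1 - p) / 2) * kummer (-p / 2) (1 / 2) (z ^ 2 / 2)
      - Real.sqrt (2 * Real.pi) * z / Real.Gamma (-p / 2)
        * kummer ((1 - p) / 2) (3 / 2) (z ^ 2 / 2))

/-- The closed form for `W (x)`, with `σ` in the place of `sgn x`. -/
def steadyClosedForm (α β ν ξ σ x : ℝ) : ℝ :=
  (2 : ℝ) ^ (ξ / α) / (Real.pi * Real.sqrt ν) * Real.Gamma (1 + ξ / (2 * α))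
    * Real.Gamma (1 / 2 + ξ / (2 * α)) * Real.exp (-(x * (x - 2 * β)) / (2 * ν))
    * parabolicCylinder (-ξ / α) (σ * β * Real.sqrt (2 / ν))
    * parabolicCylinder (-ξ / α) (σ * (x - β) * Real.sqrt (2 / ν))

end

/-! The martingale property enters only through expectations: E φ(X_t) = E φ(X_0) + E ∫_0^t Lφ(X_s)
ds. Cutoffs extend this from compactly supported φ to smooth φ for which φ, φ', xφ' and φ'' are
bounded (`IsResetOU.isForwardSolution`). This class contains the normal densities of variance 1 and
is left invariant on them by the explicit Ornstein-Uhlenbeck semigroup: if u_τ is such a density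
evolved for time τ, then ∂_τ u = L_0 u, where L_0 is the generator without resetting.
Differentiating s ↦ e^{-ξ(T-s)} E u_{T-s}(X_s) cancels everything except the gain by resetting, ξ
e^{-ξ(T-s)} u_{T-s}(0). Integration gives Duhamel's formula (`IsForwardSolution.integral_ouTest`).

Its right side is the Gaussian convolution of the renewal density e^{-ξt} f̃(·,t|y) + ξ ∫_0^t
e^{-ξr} f̃(·,r|0) dr. The characteristic function of a Gaussian has no zero, so the convolution
determines the law (`measure_eq_of_integral_heatKernel_eq`). The renewal density is continuous,
hence it is the derivative of the distribution function at every point. The case ξ = 0 is the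
process without resetting, and t → ∞ leaves W. The bound f̃ ≤ c (1 + t^{-1/2}) justifies all the
passages to the limit, including ξ → 0.

The closed form is not obtained by evaluating the Laplace integral. Instead W is characterised
weakly (`eq_steadyDensity`): a nonnegative continuous integrable C with ∫ (L_0 φ - ξφ) C = -ξ φ(0)
for all test functions is the density of a stationary law, and Duhamel's formula as t → ∞ forces C =
W. The candidate is Green's function: the weight exp(-(x-β)²/ν) times two solutions of L_0 h = ξh
glued at 0. With a = ξ/α these solutions are H_a(±√(2/ν)(x-β)), where H_a(z) = ∫_0^∞ t^{a-1}
e^{-zt-t²/2} dt. Integration by parts on each half-line leaves a Wronskian at 0, which fixes the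
constant (`integral_gluedSolution`). The power series of H_a, split by parity, gives D_{-a}(z) =
e^{-z²/4} H_a(z)/Γ(a) (`parabolicCylinder_neg`). -/

/-! ### The heat kernel -/

/-- The centred normal density with variance `V`, at `d`. -/
noncomputable def heatKernel (V d : ℝ) : ℝ :=
  (Real.sqrt (2 * Real.pi * V))⁻¹ * Real.exp (-d ^ 2 / (2 * V))

lemma gaussianPDFReal_eq_heatKernel (m : ℝ) (v : ℝ≥0) (x : ℝ) :
    gaussianPDFReal m v x = heatKernel v (x - m) := rfl

lemma heatKernel_nonneg (V d : ℝ) : 0 ≤ heatKernel V d := by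
  unfold heatKernel; positivity

lemma heatKernel_neg (V d : ℝ) : heatKernel V (-d) = heatKernel V d := by
  simp [heatKernel]

lemma heatKernel_le (V : ℝ) (hV : 0 < V) (d : ℝ) :
    heatKernel V d ≤ (Real.sqrt (2 * Real.pi * V))⁻¹ := by
  unfold heatKernel
  refine mul_le_of_le_one_right (by positivity) (Real.exp_le_one_iff.2 ?_)
  exact div_nonpos_of_nonpos_of_nonneg (by nlinarith [sq_nonneg d]) (by positivity)

lemma ContinuousOn.heatKernel {E : Type*} [TopologicalSpace E] {V d : E → ℝ} {s : Set E}
    (hV : ContinuousOn V s) (hd : ContinuousOn d s) (hpos : ∀ x ∈ s, 0 < V x) :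
    ContinuousOn (fun x => heatKernel (V x) (d x)) s := by
  unfold _root_.heatKernel
  refine ContinuousOn.mul (ContinuousOn.inv₀ (by fun_prop) fun x hx => ?_)
    (Real.continuous_exp.comp_continuousOn (ContinuousOn.div (by fun_prop) (by fun_prop)
      fun x hx => ?_))
  · have := hpos x hx; positivity
  · have := hpos x hx; positivity

lemma Continuous.heatKernel {E : Type*} [TopologicalSpace E] {V d : E → ℝ}
    (hV : Continuous V) (hd : Continuous d) (hpos : ∀ x, 0 < V x) :
    Continuous (fun x => heatKernel (V x) (d x)) := by
  rw [← continuousOn_univ] at *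
  exact hV.heatKernel hd fun x _ => hpos x

/-- Chain rule combined with the heat equation: the derivative in the variance is half the second
derivative in the displacement. -/
lemma HasDerivAt.heatKernel {V d : ℝ → ℝ} {V' d' s : ℝ} (hV : HasDerivAt V V' s)
    (hd : HasDerivAt d d' s) (hpos : 0 < V s) :
    HasDerivAt (fun r => heatKernel (V r) (d r))
      (V' / 2 * ((d s ^ 2 / V s ^ 2 - 1 / V s) * heatKernel (V s) (d s))
        - d' * (d s / V s * heatKernel (V s) (d s))) s := by
  unfold _root_.heatKernel
  have h0 : 0 < 2 * Real.pi * V s := by positivity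
  have h1 : HasDerivAt (fun r => (Real.sqrt (2 * Real.pi * V r))⁻¹) _ s :=
    ((hV.const_mul (2 * Real.pi)).sqrt h0.ne').fun_inv (by positivity)
  have h2 : HasDerivAt (fun r => Real.exp (-d r ^ 2 / (2 * V r))) _ s :=
    (((hd.fun_pow 2).fun_neg).fun_div (hV.const_mul 2) (by positivity)).exp
  refine (h1.mul h2).congr_deriv ?_
  have hs : Real.sqrt (2 * Real.pi * V s) ^ 2 = 2 * Real.pi * V s := Real.sq_sqrt h0.le
  have hs0 : Real.sqrt (2 * Real.pi * V s) ≠ 0 := by positivity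
  set q := Real.sqrt (2 * Real.pi * V s)
  have hq : q⁻¹ / q ^ 2 * (2 * Real.pi) = q⁻¹ / V s := by rw [hs]; field_simp
  have hq' : -(2 * Real.pi * V' / (2 * q)) / q ^ 2 = - (V' / 2) * (q⁻¹ / V s) := by
    rw [← hq]; field_simp
  rw [hq']
  field_simp
  ring

/-! ### Bounds for the heat kernel and its derivatives, uniform for variance at least 1 -/

lemma exp_neg_mul_self_le (u : ℝ) : Real.exp (-u) * u ≤ 1 := by
  rw [Real.exp_neg, inv_mul_le_iff₀ (Real.exp_pos u)]
  linarith [Real.add_one_le_exp u]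

lemma heatKernel_le_one {V : ℝ} (hV : 1 ≤ V) (d : ℝ) : heatKernel V d ≤ 1 := by
  refine (heatKernel_le V (by linarith) d).trans (inv_le_one_of_one_le₀ ?_)
  rw [Real.one_le_sqrt]
  nlinarith [Real.pi_gt_three]

lemma sq_div_mul_heatKernel_le {V : ℝ} (hV : 1 ≤ V) (d : ℝ) :
    d ^ 2 / V * heatKernel V d ≤ 2 := by
  have h0 : 0 < V := by linarith
  have h1 : (Real.sqrt (2 * Real.pi * V))⁻¹ ≤ 1 := by
    refine inv_le_one_of_one_le₀ ?_
    rw [Real.one_le_sqrt]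
    nlinarith [Real.pi_gt_three]
  have h2 := exp_neg_mul_self_le (d ^ 2 / (2 * V))
  have h3 : d ^ 2 / V * heatKernel V d = (Real.sqrt (2 * Real.pi * V))⁻¹ *
      (2 * (Real.exp (-(d ^ 2 / (2 * V))) * (d ^ 2 / (2 * V)))) := by
    unfold heatKernel
    rw [neg_div]; field_simp
  rw [h3]
  have h4 : 0 ≤ Real.exp (-(d ^ 2 / (2 * V))) * (d ^ 2 / (2 * V)) := by positivity
  calc _ ≤ 1 * (2 * (Real.exp (-(d ^ 2 / (2 * V))) * (d ^ 2 / (2 * V)))) := by gcongr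
    _ ≤ 2 := by linarith

lemma abs_div_mul_heatKernel_le {V : ℝ} (hV : 1 ≤ V) (d : ℝ) :
    |d / V * heatKernel V d| ≤ 2 := by
  have h0 : 0 < V := by linarith
  have h1 := sq_div_mul_heatKernel_le hV d
  have h2 := heatKernel_le_one hV d
  have h3 := heatKernel_nonneg V d
  rw [abs_mul, abs_div, abs_of_nonneg h3, abs_of_pos h0]
  have h4 : |d| / V ≤ 1 + d ^ 2 / V := by
    have h5 : |d| / V ≤ (1 + d ^ 2) / V := by
      gcongr
      nlinarith [sq_abs d, sq_nonneg (|d| - 1), abs_nonneg d]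
    have h6 : 1 / V ≤ 1 := by rw [div_le_one h0]; exact hV
    rw [add_div] at h5
    linarith
  -- For small d the kernel itself is at most 1; for large d, |d| ≤ d² reduces to the quadratic
  -- bound.
  by_cases hd : |d| ≤ 1
  · have : |d| / V ≤ 1 := by rw [div_le_one h0]; linarith
    nlinarith [div_nonneg (abs_nonneg d) h0.le]
  · push Not at hd
    have h5 : |d| / V ≤ d ^ 2 / V := by
      gcongr
      nlinarith [sq_abs d]
    nlinarith

lemma abs_self_mul_heatKernel_le {V : ℝ} (hV : 1 ≤ V) (d : ℝ) :
    |d * (d / V * heatKernel V d)| ≤ 2 := by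
  have h0 : 0 < V := by linarith
  have h3 := heatKernel_nonneg V d
  have : d * (d / V * heatKernel V d) = d ^ 2 / V * heatKernel V d := by ring
  rw [this, abs_of_nonneg (by positivity)]
  exact sq_div_mul_heatKernel_le hV d

lemma abs_second_mul_heatKernel_le {V : ℝ} (hV : 1 ≤ V) (d : ℝ) :
    |(d ^ 2 / V ^ 2 - 1 / V) * heatKernel V d| ≤ 3 := by
  have h0 : 0 < V := by linarith
  have h1 := sq_div_mul_heatKernel_le hV d
  have h2 := heatKernel_le_one hV d
  have h3 := heatKernel_nonneg V d
  have h4 : d ^ 2 / V ^ 2 ≤ d ^ 2 / V := by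
    gcongr
    nlinarith
  have h5 : 1 / V ≤ 1 := by rw [div_le_one h0]; exact hV
  have h6 : 0 ≤ d ^ 2 / V ^ 2 := by positivity
  have h7 : 0 ≤ 1 / V := by positivity
  rw [abs_le]
  constructor <;> nlinarith

/-! ### Integrals and convolutions of heat kernels -/

lemma integrable_heatKernel {V : ℝ} (hV : 0 < V) (m : ℝ) :
    Integrable (fun w => heatKernel V (w - m)) := by
  have := integrable_gaussianPDFReal m ⟨V, hV.le⟩
  exact this

lemma integral_heatKernel {V : ℝ} (hV : 0 < V) (m : ℝ) :
    ∫ w, heatKernel V (w - m) = 1 := by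
  have := integral_gaussianPDFReal_eq_one m (v := ⟨V, hV.le⟩)
    (fun h => hV.ne' (congrArg NNReal.toReal h))
  exact this

/-- Convolution of two heat kernels, one of them of variance `1`. -/
lemma integral_heatKernel_mul {V : ℝ} (hV : 0 < V) (m z : ℝ) :
    ∫ w, heatKernel 1 (z - w) * heatKernel V (w - m) = heatKernel (1 + V) (z - m) := by
  -- Completing the square in w: the precisions 1 and 1/V add up to (1 + V)/V, and the mean is the
  -- precision-weighted average of z and m. What remains is a normal density in w, of total mass 1.
  have h : ∀ w, heatKernel 1 (z - w) * heatKernel V (w - m) =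
      heatKernel (1 + V) (z - m) *
        heatKernel (V / (1 + V)) (w - (m + V * z) / (1 + V)) := by
    intro w
    unfold heatKernel
    rw [mul_mul_mul_comm, mul_mul_mul_comm (Real.sqrt (2 * Real.pi * (1 + V)))⁻¹,
      ← Real.exp_add, ← Real.exp_add, ← mul_inv, ← mul_inv, ← Real.sqrt_mul (by positivity),
      ← Real.sqrt_mul (by positivity)]
    congr 2
    · congr 1; field_simp
    · field_simp; ring
  simp_rw [h]
  rw [integral_const_mul, integral_heatKernel (by positivity), mul_one]

/-! ### Gaussian test functions evolved by the Ornstein-Uhlenbeck semigroup -/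

/-- The Ornstein-Uhlenbeck semigroup at time `τ` applied to the normal density with mean `z` and
variance `1`. -/
noncomputable def ouTest (α β ν z τ x : ℝ) : ℝ :=
  heatKernel (1 + ν / 2 * (1 - Real.exp (-2 * α * τ)))
    (z - (β * (1 - Real.exp (-α * τ)) + x * Real.exp (-α * τ)))

/-- Smooth functions for which the generator of an Ornstein-Uhlenbeck process is bounded. -/
structure IsTestFunction (φ : ℝ → ℝ) : Prop where
  smooth : ContDiff ℝ (⊤ : ℕ∞) φ
  bound : ∃ C, ∀ x, |φ x| ≤ C ∧ |deriv φ x| ≤ C ∧ |x * deriv φ x| ≤ C ∧ |deriv (deriv φ) x| ≤ C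

section
variable {α β ν z τ : ℝ}

/-- Starting from variance 1 instead of a point mass keeps the test functions free of singularities
as τ → 0; this is why laws are tested against Gaussians. -/
lemma one_le_variance (hα : 0 < α) (hν : 0 < ν) (hτ : 0 ≤ τ) :
    1 ≤ 1 + ν / 2 * (1 - Real.exp (-2 * α * τ)) := by
  have : Real.exp (-2 * α * τ) ≤ 1 := Real.exp_le_one_iff.2 (by nlinarith [mul_nonneg hα.le hτ])
  nlinarith

lemma hasDerivAt_ouTest_space (hα : 0 < α) (hν : 0 < ν) (hτ : 0 ≤ τ) (x : ℝ) :
    HasDerivAt (ouTest α β ν z τ)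
      (Real.exp (-α * τ) * ((z - (β * (1 - Real.exp (-α * τ)) + x * Real.exp (-α * τ))) /
        (1 + ν / 2 * (1 - Real.exp (-2 * α * τ))) * ouTest α β ν z τ x)) x := by
  have hV : 0 < 1 + ν / 2 * (1 - Real.exp (-2 * α * τ)) := by
    linarith [one_le_variance hα hν hτ]
  have hd : HasDerivAt (fun x : ℝ => z - (β * (1 - Real.exp (-α * τ)) + x * Real.exp (-α * τ)))
      (-(1 * Real.exp (-α * τ))) x := by
    exact (((hasDerivAt_id x).mul_const _).const_add _).const_sub _
  refine ((hasDerivAt_const x (1 + ν / 2 * (1 - Real.exp (-2 * α * τ)))).heatKernel hd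
    hV).congr_deriv ?_
  simp only [ouTest]
  ring

lemma deriv_ouTest (hα : 0 < α) (hν : 0 < ν) (hτ : 0 ≤ τ) :
    deriv (ouTest α β ν z τ) = fun x =>
      (Real.exp (-α * τ) * ((z - (β * (1 - Real.exp (-α * τ)) + x * Real.exp (-α * τ))) /
        (1 + ν / 2 * (1 - Real.exp (-2 * α * τ))) * ouTest α β ν z τ x)) :=
  funext fun x => (hasDerivAt_ouTest_space hα hν hτ x).deriv

lemma deriv_deriv_ouTest (hα : 0 < α) (hν : 0 < ν) (hτ : 0 ≤ τ) (x : ℝ) :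
    deriv (deriv (ouTest α β ν z τ)) x = Real.exp (-α * τ) ^ 2 *
      (((z - (β * (1 - Real.exp (-α * τ)) + x * Real.exp (-α * τ))) ^ 2 /
        (1 + ν / 2 * (1 - Real.exp (-2 * α * τ))) ^ 2 -
          1 / (1 + ν / 2 * (1 - Real.exp (-2 * α * τ)))) * ouTest α β ν z τ x) := by
  have hV : 0 < 1 + ν / 2 * (1 - Real.exp (-2 * α * τ)) := by
    linarith [one_le_variance hα hν hτ]
  have hd : HasDerivAt (fun x : ℝ => z - (β * (1 - Real.exp (-α * τ)) + x * Real.exp (-α * τ)))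
      (-(1 * Real.exp (-α * τ))) x := by
    exact (((hasDerivAt_id x).mul_const _).const_add _).const_sub _
  rw [deriv_ouTest hα hν hτ]
  refine HasDerivAt.deriv ((((hd.div_const _).mul
    (hasDerivAt_ouTest_space hα hν hτ x)).const_mul _).congr_deriv ?_)
  field_simp
  ring

/-- Backward equation. The mean m = β(1 - ρ) + xρ with ρ = e^{-ατ} satisfies ∂_τ m = -α(x - β) ∂_x
m, which produces the drift; the variance grows at rate αν ρ² = αν (∂_x m)², which by the heat
equation produces the diffusion term. The reset part of the generator is subtracted again, so any ξ
may appear. -/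
lemma hasDerivAt_ouTest_time (hα : 0 < α) (hν : 0 < ν) (hτ : 0 ≤ τ) (ξ x : ℝ) :
    HasDerivAt (fun r => ouTest α β ν z r x)
      (resetGenerator α β ν ξ (ouTest α β ν z τ) x
        - ξ * (ouTest α β ν z τ 0 - ouTest α β ν z τ x)) τ := by
  have hV : 0 < 1 + ν / 2 * (1 - Real.exp (-2 * α * τ)) := by
    linarith [one_le_variance hα hν hτ]
  have he : ∀ c : ℝ, HasDerivAt (fun r : ℝ => Real.exp (c * r)) (Real.exp (c * τ) * c) τ := by
    intro c
    simpa using ((hasDerivAt_id τ).const_mul c).exp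
  have hd : HasDerivAt (fun r : ℝ => z - (β * (1 - Real.exp (-α * r)) + x * Real.exp (-α * r)))
      (-(β * -(Real.exp (-α * τ) * -α) + x * (Real.exp (-α * τ) * -α))) τ :=
    ((((he _).const_sub _).const_mul _).add ((he _).const_mul _)).const_sub _
  have hv : HasDerivAt (fun r : ℝ => 1 + ν / 2 * (1 - Real.exp (-2 * α * r)))
      (ν / 2 * -(Real.exp (-2 * α * τ) * (-2 * α))) τ :=
    (((he _).const_sub _).const_mul _).const_add _
  refine (hv.heatKernel hd hV).congr_deriv ?_
  have h2 : Real.exp (-2 * α * τ) = Real.exp (-α * τ) ^ 2 := by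
    rw [← Real.exp_nat_mul]; congr 1; push_cast; ring
  rw [resetGenerator, deriv_deriv_ouTest hα hν hτ, deriv_ouTest hα hν hτ]
  simp only [ouTest]
  rw [h2]
  ring

/-- Bounds for the test functions that are uniform in time and space. -/
lemma exists_bound_ouTest (hα : 0 < α) (hν : 0 < ν) (β z : ℝ) :
    ∃ C, ∀ τ, 0 ≤ τ → ∀ x, |ouTest α β ν z τ x| ≤ C ∧ |deriv (ouTest α β ν z τ) x| ≤ C ∧
      |x * deriv (ouTest α β ν z τ) x| ≤ C ∧ |deriv (deriv (ouTest α β ν z τ)) x| ≤ C := by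
  -- The first three summands bound x times the derivative, through xρ = (z - β) - d + βρ, where d
  -- is the displacement and ρ = e^{-ατ} ≤ 1; the 3 bounds the second derivative.
  refine ⟨2 * |z - β| + 2 + 2 * |β| + 3, fun τ hτ x => ?_⟩
  have hV := one_le_variance hα hν hτ
  rw [deriv_deriv_ouTest hα hν hτ, deriv_ouTest hα hν hτ]
  have hρ1 : Real.exp (-α * τ) ≤ 1 := Real.exp_le_one_iff.2 (by nlinarith [mul_nonneg hα.le hτ])
  have hρ0 := Real.exp_pos (-α * τ)
  simp only [ouTest]
  set ρ := Real.exp (-α * τ)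
  set V := 1 + ν / 2 * (1 - Real.exp (-2 * α * τ))
  set d := z - (β * (1 - ρ) + x * ρ) with hd
  have h0 := heatKernel_nonneg V d
  have h1 := heatKernel_le_one hV d
  have h2 := abs_div_mul_heatKernel_le hV d
  have h3 := abs_self_mul_heatKernel_le hV d
  have h4 := abs_second_mul_heatKernel_le hV d
  have hz := abs_nonneg (z - β)
  have hb := abs_nonneg β
  set k1 := d / V * heatKernel V d
  set k2 := (d ^ 2 / V ^ 2 - 1 / V) * heatKernel V d
  have h5 : |ρ * k1| ≤ 2 := by
    rw [abs_mul, abs_of_pos hρ0]; nlinarith [abs_nonneg k1]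
  refine ⟨?_, ?_, ?_, ?_⟩
  · rw [abs_of_nonneg h0]; linarith
  · linarith
  · have : x * (ρ * k1) = ((z - β) * k1 - d * k1) + β * (ρ * k1) := by rw [hd]; ring
    rw [this]
    refine (abs_add_le _ _).trans ?_
    have h6 := abs_sub ((z - β) * k1) (d * k1)
    rw [abs_mul] at h6
    rw [abs_mul β]
    nlinarith
  · rw [abs_mul, abs_of_pos (by positivity)]
    have : ρ ^ 2 ≤ 1 := by nlinarith
    nlinarith [abs_nonneg k2]

lemma contDiff_ouTest :
    ContDiff ℝ (⊤ : ℕ∞) (ouTest α β ν z τ) := by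
  unfold ouTest heatKernel
  fun_prop

lemma isTestFunction_ouTest (hα : 0 < α) (hν : 0 < ν) (hτ : 0 ≤ τ) :
    IsTestFunction (ouTest α β ν z τ) := by
  obtain ⟨C, hC⟩ := exists_bound_ouTest hα hν β z
  exact ⟨contDiff_ouTest, C, fun x => hC τ hτ x⟩

/-- Constants are needed in `eq_steadyDensity`, where φ = 1 yields the total mass. -/
lemma isTestFunction_const (c : ℝ) : IsTestFunction (fun _ => c) :=
  ⟨contDiff_const, |c|, fun x => by simp⟩

lemma IsTestFunction.continuous_deriv {φ : ℝ → ℝ} (h : IsTestFunction φ) :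
    Continuous (deriv φ) := h.smooth.continuous_deriv (by simp)

lemma IsTestFunction.contDiff_deriv {φ : ℝ → ℝ} (h : IsTestFunction φ) :
    ContDiff ℝ (⊤ : ℕ∞) (deriv φ) := by
  have := h.smooth
  rw [show ((⊤ : ℕ∞) : WithTop ℕ∞) = (⊤ : ℕ∞) + 1 from rfl, contDiff_succ_iff_deriv] at this
  exact this.2.2

lemma IsTestFunction.continuous_deriv_deriv {φ : ℝ → ℝ} (h : IsTestFunction φ) :
    Continuous (deriv (deriv φ)) := h.contDiff_deriv.continuous_deriv (by simp)

lemma IsTestFunction.continuous_resetGenerator {φ : ℝ → ℝ} (h : IsTestFunction φ) (ξ : ℝ) :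
    Continuous (resetGenerator α β ν ξ φ) := by
  have h1 := h.continuous_deriv
  have h2 := h.continuous_deriv_deriv
  have h3 := h.smooth.continuous
  unfold resetGenerator
  fun_prop

/-- The unbounded drift meets φ only through the product xφ'(x). The factor in front of C does not
depend on φ, so families with a common C (the cutoffs, the evolved Gaussians) have uniformly bounded
images. -/
lemma abs_resetGenerator_le {φ : ℝ → ℝ} {C x : ℝ} (ξ : ℝ) (h0 : |φ 0| ≤ C) (h : |φ x| ≤ C)
    (h1 : |deriv φ x| ≤ C) (h2 : |x * deriv φ x| ≤ C) (h3 : |deriv (deriv φ) x| ≤ C) :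
    |resetGenerator α β ν ξ φ x| ≤
      (|α| + |α * β| + |1 / 2 * (α * ν)| + 2 * |ξ|) * C := by
  have : resetGenerator α β ν ξ φ x = -α * (x * deriv φ x) + (α * β) * deriv φ x
      + (1 / 2 * (α * ν)) * deriv (deriv φ) x + (ξ * φ 0 - ξ * φ x) := by
    unfold resetGenerator; ring
  rw [this]
  have e1 : |-α * (x * deriv φ x)| ≤ |α| * C := by rw [abs_mul, abs_neg]; gcongr
  have e2 : |(α * β) * deriv φ x| ≤ |α * β| * C := by rw [abs_mul]; gcongr
  have e3 : |(1 / 2 * (α * ν)) * deriv (deriv φ) x| ≤ |1 / 2 * (α * ν)| * C := by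
    rw [abs_mul]; gcongr
  have e4 : |ξ * φ 0| ≤ |ξ| * C := by rw [abs_mul]; gcongr
  have e5 : |ξ * φ x| ≤ |ξ| * C := by rw [abs_mul]; gcongr
  have e6 := abs_sub (ξ * φ 0) (ξ * φ x)
  refine (abs_add_le _ _).trans ?_
  refine (add_le_add_left ((abs_add_le _ _).trans
    (add_le_add_left (abs_add_le _ _) _)) _).trans ?_
  linarith

lemma IsTestFunction.exists_bound_resetGenerator {φ : ℝ → ℝ} (h : IsTestFunction φ)
    (α β ν ξ : ℝ) : ∃ C, ∀ x, |resetGenerator α β ν ξ φ x| ≤ C := by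
  obtain ⟨C, hC⟩ := h.bound
  exact ⟨_, fun x => abs_resetGenerator_le ξ (hC 0).1 (hC x).1 (hC x).2.1 (hC x).2.2.1
    (hC x).2.2.2⟩

/-- Joint continuity of the test functions. -/
lemma continuousOn_ouTest (hα : 0 < α) (hν : 0 < ν) :
    ContinuousOn (fun p : ℝ × ℝ => ouTest α β ν z p.1 p.2) (Ici 0 ×ˢ univ) := by
  unfold ouTest
  refine ContinuousOn.heatKernel (by fun_prop) (by fun_prop) fun p hp => ?_
  linarith [one_le_variance hα hν (show 0 ≤ p.1 from hp.1)]

/-- Continuity has to be joint because time derivatives are later evaluated along a moving path. -/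
lemma continuousOn_resetGenerator_ouTest (hα : 0 < α) (hν : 0 < ν) (ξ : ℝ) :
    ContinuousOn (fun p : ℝ × ℝ => resetGenerator α β ν ξ (ouTest α β ν z p.1) p.2)
      (Ici 0 ×ˢ univ) := by
  have h0 := continuousOn_ouTest (z := z) (β := β) hα hν
  have h1 : ContinuousOn (fun p : ℝ × ℝ => ouTest α β ν z p.1 0) (Ici 0 ×ˢ univ) := by
    refine h0.comp (f := fun p : ℝ × ℝ => (p.1, (0 : ℝ))) (by fun_prop) fun p hp => ?_
    exact ⟨hp.1, mem_univ _⟩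
  have hV : ∀ p ∈ (Ici 0 ×ˢ univ : Set (ℝ × ℝ)),
      1 + ν / 2 * (1 - Real.exp (-2 * α * p.1)) ≠ 0 := fun p hp => by
    linarith [one_le_variance hα hν (show 0 ≤ p.1 from hp.1)] |> ne_of_gt
  have key : ContinuousOn (fun p : ℝ × ℝ => -α * (p.2 - β) *
      (Real.exp (-α * p.1) * ((z - (β * (1 - Real.exp (-α * p.1)) + p.2 * Real.exp (-α * p.1))) /
        (1 + ν / 2 * (1 - Real.exp (-2 * α * p.1))) * ouTest α β ν z p.1 p.2))
      + (1 / 2) * (α * ν) * (Real.exp (-α * p.1) ^ 2 *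
      (((z - (β * (1 - Real.exp (-α * p.1)) + p.2 * Real.exp (-α * p.1))) ^ 2 /
        (1 + ν / 2 * (1 - Real.exp (-2 * α * p.1))) ^ 2 -
          1 / (1 + ν / 2 * (1 - Real.exp (-2 * α * p.1)))) * ouTest α β ν z p.1 p.2))
      + ξ * (ouTest α β ν z p.1 0 - ouTest α β ν z p.1 p.2)) (Ici 0 ×ˢ univ) := by
    have hV2 : ∀ p ∈ (Ici 0 ×ˢ univ : Set (ℝ × ℝ)),
      (1 + ν / 2 * (1 - Real.exp (-2 * α * p.1))) ^ 2 ≠ 0 := fun p hp => pow_ne_zero 2 (hV p hp)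
    have d1 : ContinuousOn (fun p : ℝ × ℝ => (z - (β * (1 - Real.exp (-α * p.1)) +
      p.2 * Real.exp (-α * p.1))) / (1 + ν / 2 * (1 - Real.exp (-2 * α * p.1))))
        (Ici 0 ×ˢ univ) := ContinuousOn.div (by fun_prop) (by fun_prop) hV
    have d2 : ContinuousOn (fun p : ℝ × ℝ => (z - (β * (1 - Real.exp (-α * p.1)) +
      p.2 * Real.exp (-α * p.1))) ^ 2 / (1 + ν / 2 * (1 - Real.exp (-2 * α * p.1))) ^ 2)
        (Ici 0 ×ˢ univ) := ContinuousOn.div (by fun_prop) (by fun_prop) hV2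
    have d3 : ContinuousOn (fun p : ℝ × ℝ => 1 / (1 + ν / 2 * (1 - Real.exp (-2 * α * p.1))))
        (Ici 0 ×ˢ univ) := ContinuousOn.div (by fun_prop) (by fun_prop) hV
    fun_prop
  refine key.congr fun p hp => ?_
  have hp : 0 ≤ p.1 := hp.1
  simp only [resetGenerator, deriv_deriv_ouTest hα hν hp]
  rw [deriv_ouTest hα hν hp]

end

/-! ### From the martingale problem to the forward equation -/

/-- f is the pointwise limit of the step functions that evaluate it at the first point of the grid
ℤ/(n+1) strictly to the right of s; these points lie within 1/(n+1) of s. -/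
lemma measurable_of_right_continuous {f : ℝ → ℝ}
    (hf : ∀ s, ContinuousWithinAt f (Ici s) s) : Measurable f := by
  have hm : ∀ n : ℕ, Measurable
      (fun s : ℝ => f (((⌊((n : ℝ) + 1) * s⌋ : ℤ) + 1 : ℝ) / ((n : ℝ) + 1))) := by
    intro n
    exact (measurable_from_top (f := fun k : ℤ => f (((k : ℝ) + 1) / ((n : ℝ) + 1)))).comp
      (Int.measurable_floor.comp (measurable_id.const_mul _))
  refine measurable_of_tendsto_metrizable hm (tendsto_pi_nhds.2 fun s => ?_)
  refine (hf s).tendsto.comp (tendsto_nhdsWithin_iff.2 ⟨?_, Eventually.of_forall fun n => ?_⟩)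
  · have h1 : Tendsto (fun n : ℕ => s + 1 / ((n : ℝ) + 1)) atTop (𝓝 (s + 0)) :=
      tendsto_one_div_add_atTop_nhds_zero_nat.const_add s
    rw [add_zero] at h1
    refine tendsto_of_tendsto_of_tendsto_of_le_of_le tendsto_const_nhds h1 (fun n => ?_)
      (fun n => ?_)
    · have h2 : (0 : ℝ) < (n : ℝ) + 1 := by positivity
      show s ≤ _
      rw [le_div_iff₀ h2, mul_comm]
      exact (Int.lt_floor_add_one _).le
    · have h2 : (0 : ℝ) < (n : ℝ) + 1 := by positivity
      show _ ≤ s + _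
      have h3 : (s + 1 / ((n : ℝ) + 1)) * ((n : ℝ) + 1) = ((n : ℝ) + 1) * s + 1 := by
        field_simp
      rw [div_le_iff₀ h2, h3]
      linarith [Int.floor_le (((n : ℝ) + 1) * s)]
  · have h2 : (0 : ℝ) < (n : ℝ) + 1 := by positivity
    show s ≤ _
    rw [le_div_iff₀ h2, mul_comm]
    exact (Int.lt_floor_add_one _).le

lemma right_continuous_toNNReal {x : ℝ≥0 → ℝ} (hx : ∀ t, ContinuousWithinAt x (Ici t) t) (s : ℝ) :
    ContinuousWithinAt (fun r : ℝ => x r.toNNReal) (Ici s) s :=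
  (hx s.toNNReal).comp continuous_real_toNNReal.continuousWithinAt
    fun _ hr => Real.toNNReal_le_toNNReal hr

lemma IsTestFunction.of_hasCompactSupport {φ : ℝ → ℝ} (h : ContDiff ℝ (⊤ : ℕ∞) φ)
    (hc : HasCompactSupport φ) : IsTestFunction φ := by
  have h1 : ContDiff ℝ (⊤ : ℕ∞) (deriv φ) := by
    rw [show ((⊤ : ℕ∞) : WithTop ℕ∞) = (⊤ : ℕ∞) + 1 from rfl, contDiff_succ_iff_deriv] at h
    exact h.2.2
  have h2 : Continuous (deriv (deriv φ)) := h1.continuous_deriv (by simp)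
  obtain ⟨C0, h0⟩ := hc.exists_bound_of_continuous h.continuous
  obtain ⟨C1, h1'⟩ := hc.deriv.exists_bound_of_continuous h1.continuous
  obtain ⟨C2, h2'⟩ := (hc.deriv.mul_left (f := fun x : ℝ => x)).exists_bound_of_continuous
    (continuous_id.mul h1.continuous)
  obtain ⟨C3, h3'⟩ := hc.deriv.deriv.exists_bound_of_continuous h2
  refine ⟨h, max (max C0 C1) (max C2 C3), fun x => ⟨?_, ?_, ?_, ?_⟩⟩
  · exact (h0 x).trans (by simp)
  · exact (h1' x).trans (by simp)
  · exact (h2' x).trans (by simp)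
  · exact (h3' x).trans (by simp)

lemma hasDerivAt_cutoff {χ φ : ℝ → ℝ} (hχ : Differentiable ℝ χ) (hφ : Differentiable ℝ φ)
    (c x : ℝ) : HasDerivAt (fun x => χ (c * x) * φ x)
      (c * (deriv χ (c * x) * φ x) + χ (c * x) * deriv φ x) x := by
  have h1 : HasDerivAt (fun x : ℝ => c * x) c x := by
    simpa using (hasDerivAt_id x).const_mul c
  have h2 : HasDerivAt (fun x => χ (c * x)) (deriv χ (c * x) * c) x :=
    (hχ (c * x)).hasDerivAt.comp x h1
  exact (h2.mul (hφ x).hasDerivAt).congr_deriv (by ring)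

/-- Test functions are bounded limits of smooth compactly supported functions, together with
their images under the generator. -/
lemma IsTestFunction.exists_approx {φ : ℝ → ℝ} (h : IsTestFunction φ) (α β ν ξ : ℝ) :
    ∃ (ψ : ℕ → ℝ → ℝ) (C : ℝ), (∀ n, ContDiff ℝ (⊤ : ℕ∞) (ψ n)) ∧ (∀ n, HasCompactSupport (ψ n)) ∧
      (∀ n x, |ψ n x| ≤ C) ∧ (∀ n x, |resetGenerator α β ν ξ (ψ n) x| ≤ C) ∧
      ∀ x, ∀ᶠ n in atTop, ψ n x = φ x ∧
        resetGenerator α β ν ξ (ψ n) x = resetGenerator α β ν ξ φ x := by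
  let b : ContDiffBump (0 : ℝ) := ⟨1, 2, by norm_num, by norm_num⟩
  have hb : ContDiff ℝ (⊤ : ℕ∞) b := b.contDiff
  have hbt := IsTestFunction.of_hasCompactSupport hb b.hasCompactSupport
  obtain ⟨A, hA⟩ := hbt.bound
  obtain ⟨C, hC⟩ := h.bound
  have hA0 : 0 ≤ A := (abs_nonneg _).trans (hA 0).1
  have hC0 : 0 ≤ C := (abs_nonneg _).trans (hC 0).1
  -- The approximants are φ times a bump stretched by the factor n + 1.
  set c : ℕ → ℝ := fun n => 1 / ((n : ℝ) + 1) with hc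
  have hcpos : ∀ n, 0 < c n := fun n => by rw [hc]; positivity
  have hc1 : ∀ n, c n ≤ 1 := fun n => by
    rw [hc]; exact (div_le_one (by positivity)).2 (by linarith [n.cast_nonneg (α := ℝ)])
  set ψ : ℕ → ℝ → ℝ := fun n x => b (c n * x) * φ x with hψ
  have hbd := hb.differentiable (by simp)
  have hφd := h.smooth.differentiable (by simp)
  have hbd' := hbt.contDiff_deriv.differentiable (by simp)
  have hφd' := h.contDiff_deriv.differentiable (by simp)
  have hd1 : ∀ n, deriv (ψ n) = fun x =>
      c n * (deriv b (c n * x) * φ x) + b (c n * x) * deriv φ x := fun n =>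
    funext fun x => (hasDerivAt_cutoff hbd hφd (c n) x).deriv
  have hd2 : ∀ n x, deriv (deriv (ψ n)) x = c n *
      (c n * (deriv (deriv b) (c n * x) * φ x) + deriv b (c n * x) * deriv φ x) +
      (c n * (deriv b (c n * x) * deriv φ x) + b (c n * x) * deriv (deriv φ) x) := by
    intro n x
    rw [hd1]
    exact (((hasDerivAt_cutoff hbd' hφd (c n) x).const_mul (c n)).add
      (hasDerivAt_cutoff hbd hφd' (c n) x)).deriv
  have hmul : ∀ u v : ℝ, |u| ≤ A → |v| ≤ C → |u * v| ≤ A * C := fun u v hu hv => by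
    rw [abs_mul]; gcongr
  have hcm : ∀ n u, |c n * u| ≤ |u| := fun n u => by
    rw [abs_mul, abs_of_pos (hcpos n)]
    exact mul_le_of_le_one_left (abs_nonneg u) (hc1 n)
  have hAC : 0 ≤ A * C := by positivity
  -- The product rule for the second derivative gives four products, each at most A * C since the
  -- scaling factors are at most 1.
  have hbound : ∀ n x, |ψ n x| ≤ 4 * (A * C) ∧ |deriv (ψ n) x| ≤ 4 * (A * C) ∧
      |x * deriv (ψ n) x| ≤ 4 * (A * C) ∧ |deriv (deriv (ψ n)) x| ≤ 4 * (A * C) := by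
    intro n x
    obtain ⟨a0, a1, a2, a3⟩ := hA (c n * x)
    obtain ⟨c0, c1, c2, c3⟩ := hC x
    rw [hd2, hd1]
    refine ⟨?_, ?_, ?_, ?_⟩
    · linarith [hmul _ _ a0 c0]
    · refine (abs_add_le _ _).trans ?_
      linarith [(hcm n _).trans (hmul _ _ a1 c0), hmul _ _ a0 c1]
    -- The factor x is absorbed by the scaling: with y = c n * x the dangerous term is y b'(y),
    -- bounded because b is itself a test function.
    · have : x * (c n * (deriv b (c n * x) * φ x) + b (c n * x) * deriv φ x) =
        (c n * x * deriv b (c n * x)) * φ x + b (c n * x) * (x * deriv φ x) := by ring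
      rw [this]
      refine (abs_add_le _ _).trans ?_
      linarith [hmul _ _ a2 c0, hmul _ _ a0 c2]
    · refine (abs_add_le _ _).trans ?_
      have e1 := (hcm n (c n * (deriv (deriv b) (c n * x) * φ x)
        + deriv b (c n * x) * deriv φ x)).trans (abs_add_le _ _)
      have e2 := abs_add_le (c n * (deriv b (c n * x) * deriv φ x))
        (b (c n * x) * deriv (deriv φ) x)
      linarith [(hcm n _).trans (hmul _ _ a3 c0), hmul _ _ a1 c1,
        (hcm n _).trans (hmul _ _ a1 c1), hmul _ _ a0 c3]
  -- Equality near x, not only at x, so that derivatives agree too: convergence is eventual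
  -- equality.
  have hloc : ∀ n : ℕ, ∀ x : ℝ, |x| < n + 1 → ψ n =ᶠ[𝓝 x] φ := by
    intro n x hx
    have : ∀ᶠ y : ℝ in 𝓝 x, |y| < n + 1 := continuous_abs.continuousAt.eventually_lt_const hx
    filter_upwards [this] with y hy
    have : b (c n * y) = 1 := by
      apply b.one_of_mem_closedBall
      rw [mem_closedBall_zero_iff, Real.norm_eq_abs, abs_mul, abs_of_pos (hcpos n), hc]
      show 1 / ((n : ℝ) + 1) * |y| ≤ 1
      rw [one_div, inv_mul_le_iff₀ (by positivity)]
      linarith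
    rw [hψ]
    simp [this]
  refine ⟨ψ, max (4 * (A * C))
    ((|α| + |α * β| + |1 / 2 * (α * ν)| + 2 * |ξ|) * (4 * (A * C))), fun n => ?_, fun n => ?_,
    fun n x => ?_, fun n x => ?_, fun x => ?_⟩
  · exact (hb.comp (contDiff_const.mul contDiff_id)).mul h.smooth
  · refine HasCompactSupport.mul_right ?_
    exact b.hasCompactSupport.comp_homeomorph (Homeomorph.mulLeft₀ (c n) (hcpos n).ne')
  · exact (hbound n x).1.trans (le_max_left _ _)
  · exact (abs_resetGenerator_le ξ (hbound n 0).1 (hbound n x).1 (hbound n x).2.1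
      (hbound n x).2.2.1 (hbound n x).2.2.2).trans (le_max_right _ _)
  · obtain ⟨N, hN⟩ := exists_nat_gt |x|
    filter_upwards [eventually_ge_atTop N] with n hn
    have hx : |x| < n + 1 := by
      have : (N : ℝ) ≤ n := by exact_mod_cast hn
      linarith
    have e1 := hloc n x hx
    -- The reset term also evaluates the function at 0.
    have e0 := hloc n 0 (by simp; positivity)
    refine ⟨e1.eq_of_nhds, ?_⟩
    simp only [resetGenerator, e1.eq_of_nhds, e0.eq_of_nhds, e1.deriv_eq, e1.deriv.deriv_eq]

/-- A right-continuous process whose one-dimensional laws satisfy the forward equation for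
`resetGenerator α β ν ξ` on the test functions. -/
structure IsForwardSolution {Ω : Type*} [MeasurableSpace Ω] (α β ν ξ : ℝ) (P : Measure Ω)
    (X : ℝ≥0 → Ω → ℝ) : Prop where
  measurable : ∀ t, Measurable (X t)
  right_continuous : ∀ ω t, ContinuousWithinAt (fun s => X s ω) (Ici t) t
  aestronglyMeasurable : ∀ φ, IsTestFunction φ → ∀ t : ℝ≥0, AEStronglyMeasurable
    (fun ω => ∫ s in (0 : ℝ)..t, resetGenerator α β ν ξ φ (X s.toNNReal ω)) P
  forward : ∀ φ, IsTestFunction φ → ∀ t : ℝ≥0, ∫ ω, φ (X t ω) ∂P = ∫ ω, φ (X 0 ω) ∂P +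
    ∫ ω, (∫ s in (0 : ℝ)..t, resetGenerator α β ν ξ φ (X s.toNNReal ω)) ∂P

lemma abs_intervalIntegral_le_of_bound {f : ℝ → ℝ} {C : ℝ} (hf : ∀ x, |f x| ≤ C) (t : ℝ≥0) :
    |∫ s in (0 : ℝ)..t, f s| ≤ C * t := by
  have := intervalIntegral.norm_integral_le_of_norm_le_const (a := 0) (b := (t : ℝ)) (f := f)
    (C := C) fun x _ => hf x
  simpa using this

lemma IsResetOU.isForwardSolution {Ω : Type*} [mΩ : MeasurableSpace Ω] {α β ν ξ y : ℝ}
    {P : Measure Ω} [IsProbabilityMeasure P] {ℱ : Filtration ℝ≥0 mΩ} {X : ℝ≥0 → Ω → ℝ}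
    (h : IsResetOU α β ν ξ y P ℱ X) : IsForwardSolution α β ν ξ P X := by
  have hmeas : ∀ t, Measurable (X t) := fun t => (h.adapted t).mono (ℱ.le t) le_rfl
  have hpath : ∀ ω, Measurable fun s : ℝ => X s.toNNReal ω := fun ω =>
    measurable_of_right_continuous (right_continuous_toNNReal (h.right_continuous ω))
  have key : ∀ φ, IsTestFunction φ → ∀ t : ℝ≥0, AEStronglyMeasurable
      (fun ω => ∫ s in (0 : ℝ)..t, resetGenerator α β ν ξ φ (X s.toNNReal ω)) P ∧
      ∫ ω, (φ (X t ω) - φ (X 0 ω)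
        - ∫ s in (0 : ℝ)..t, resetGenerator α β ν ξ φ (X s.toNNReal ω)) ∂P = 0 := by
    intro φ hφ t
    obtain ⟨ψ, C, hsm, hcs, hb, hLb, hlim⟩ := hφ.exists_approx α β ν ξ
    have hψt : ∀ n, IsTestFunction (ψ n) := fun n => .of_hasCompactSupport (hsm n) (hcs n)
    set A : ℕ → Ω → ℝ := fun n ω =>
      ∫ s in (0 : ℝ)..t, resetGenerator α β ν ξ (ψ n) (X s.toNNReal ω) with hA
    have hmart := fun n => h.martingale (ψ n) (hsm n) (hcs n)
    have hψm : ∀ n (s : ℝ≥0), Measurable fun ω => ψ n (X s ω) := fun n s =>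
      (hsm n).continuous.measurable.comp (hmeas s)
    have hAm : ∀ n, AEStronglyMeasurable (A n) P := by
      intro n
      -- Measurability in ω of the time integral is read off the martingale, from which it differs
      -- by a measurable function and a sign.
      have h1 := ((hmart n).integrable t).aestronglyMeasurable
      have h2 := (((hψm n t).aestronglyMeasurable (μ := P)).sub
        ((hψm n 0).aestronglyMeasurable)).sub h1
      refine h2.congr (Eventually.of_forall fun ω => ?_)
      simp [hA]
    have hAlim : ∀ ω, Tendsto (fun n => A n ω) atTop
        (𝓝 (∫ s in (0 : ℝ)..t, resetGenerator α β ν ξ φ (X s.toNNReal ω))) := by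
      intro ω
      refine intervalIntegral.tendsto_integral_filter_of_dominated_convergence (fun _ => C)
        (Eventually.of_forall fun n => ?_) (Eventually.of_forall fun n => ?_) (by simp) ?_
      · exact (((hψt n).continuous_resetGenerator ξ).measurable.comp
          (hpath ω)).aestronglyMeasurable
      · exact Eventually.of_forall fun s _ => hLb n _
      · exact Eventually.of_forall fun s _ => tendsto_const_nhds.congr'
          ((hlim (X s.toNNReal ω)).mono fun n hn => hn.2.symm)
    refine ⟨aestronglyMeasurable_of_tendsto_ae atTop hAm (Eventually.of_forall hAlim), ?_⟩
    -- The martingale vanishes at time 0 and has constant expectation.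
    have hzero : ∀ n, ∫ ω, (ψ n (X t ω) - ψ n (X 0 ω) - A n ω) ∂P = 0 := by
      intro n
      have := (hmart n).setIntegral_eq (zero_le (a := t)) (MeasurableSet.univ)
      simpa using this.symm
    have hl : Tendsto (fun n => ∫ ω, (ψ n (X t ω) - ψ n (X 0 ω) - A n ω) ∂P) atTop
        (𝓝 (∫ ω, (φ (X t ω) - φ (X 0 ω)
        - ∫ s in (0 : ℝ)..t, resetGenerator α β ν ξ φ (X s.toNNReal ω)) ∂P)) := by
      refine tendsto_integral_of_dominated_convergence (fun _ => C + C + C * t) (fun n => ?_)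
        (integrable_const _) (fun n => Eventually.of_forall fun ω => ?_)
        (Eventually.of_forall fun ω => ?_)
      · exact (((hψm n t).aestronglyMeasurable).sub ((hψm n 0).aestronglyMeasurable)).sub (hAm n)
      · have h1 := abs_intervalIntegral_le_of_bound (t := t)
          (fun s => hLb n (X (Real.toNNReal s) ω))
        rw [Real.norm_eq_abs]
        refine (abs_sub _ _).trans (add_le_add ((abs_sub _ _).trans
          (add_le_add (hb n _) (hb n _))) h1)
      · refine Tendsto.sub (Tendsto.sub ?_ ?_) (hAlim ω)
        · exact tendsto_const_nhds.congr' ((hlim (X t ω)).mono fun n hn => hn.1.symm)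
        · exact tendsto_const_nhds.congr' ((hlim (X 0 ω)).mono fun n hn => hn.1.symm)
    simp_rw [hzero] at hl
    exact (tendsto_nhds_unique hl tendsto_const_nhds)
  refine ⟨hmeas, h.right_continuous, fun φ hφ t => (key φ hφ t).1, fun φ hφ t => ?_⟩
  obtain ⟨hm, hz⟩ := key φ hφ t
  obtain ⟨C, hC⟩ := hφ.bound
  obtain ⟨K, hK⟩ := hφ.exists_bound_resetGenerator α β ν ξ
  have hi : ∀ s : ℝ≥0, Integrable (fun ω => φ (X s ω)) P := fun s =>
    Integrable.of_bound ((hφ.smooth.continuous.measurable.comp (hmeas s)).aestronglyMeasurable) C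
      (Eventually.of_forall fun ω => (hC _).1)
  have hiA : Integrable
      (fun ω => ∫ s in (0 : ℝ)..t, resetGenerator α β ν ξ φ (X s.toNNReal ω)) P :=
    Integrable.of_bound hm (K * t) (Eventually.of_forall fun ω =>
      abs_intervalIntegral_le_of_bound (fun s => hK _) t)
  have hi' : Integrable (fun ω => φ (X t ω) - φ (X 0 ω)) P := (hi t).sub (hi 0)
  rw [integral_sub hi' hiA, integral_sub (hi t) (hi 0)] at hz
  linarith

/-! ### Duhamel's formula for the forward equation -/

/-- The difference quotient is taken in time only, but at the moving point y r. The mean value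
theorem turns it into w c (y r) with c between s and r; joint continuity of w and right continuity
of y give the limit. -/
lemma tendsto_slope_along {u w : ℝ → ℝ → ℝ} {y : ℝ → ℝ} {s t : ℝ} (hst : s < t)
    (hu : ∀ x, ∀ r ∈ Icc s t, HasDerivAt (fun r => u r x) (w r x) r)
    (hw : ContinuousWithinAt (fun p : ℝ × ℝ => w p.1 p.2) (Icc s t ×ˢ univ) (s, y s))
    (hy : ContinuousWithinAt y (Ici s) s) :
    Tendsto (fun r => (r - s)⁻¹ * (u r (y r) - u s (y r))) (𝓝[>] s) (𝓝 (w s (y s))) := by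
  have hmvt : ∀ r, r ∈ Ioo s t → ∃ c ∈ Ioo s r, w c (y r) =
      (r - s)⁻¹ * (u r (y r) - u s (y r)) := by
    intro r hr
    obtain ⟨c, hc, hce⟩ := exists_hasDerivAt_eq_slope (fun r' => u r' (y r))
      (fun r' => w r' (y r)) hr.1
      (fun r' hr' => (hu (y r) r' ⟨hr'.1, hr'.2.trans hr.2.le⟩).continuousAt.continuousWithinAt)
      (fun r' hr' => hu (y r) r' ⟨hr'.1.le, hr'.2.le.trans hr.2.le⟩)
    exact ⟨c, hc, by rw [hce, div_eq_inv_mul]⟩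
  choose! c hc hce using hmvt
  have hIoo : ∀ᶠ r in 𝓝[>] s, r ∈ Ioo s t := Ioo_mem_nhdsGT hst
  have hr : Tendsto (fun r : ℝ => r) (𝓝[>] s) (𝓝 s) :=
    tendsto_nhdsWithin_of_tendsto_nhds tendsto_id
  have h1 : Tendsto c (𝓝[>] s) (𝓝 s) :=
    tendsto_of_tendsto_of_tendsto_of_le_of_le' tendsto_const_nhds hr
      (hIoo.mono fun r h => (hc r h).1.le) (hIoo.mono fun r h => (hc r h).2.le)
  have h2 : Tendsto y (𝓝[>] s) (𝓝 (y s)) :=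
    hy.tendsto.mono_left (nhdsWithin_mono _ Ioi_subset_Ici_self)
  have h3 : Tendsto (fun r => (c r, y r)) (𝓝[>] s) (𝓝[Icc s t ×ˢ univ] (s, y s)) := by
    refine tendsto_nhdsWithin_iff.2 ⟨h1.prodMk_nhds h2, hIoo.mono fun r h => ⟨⟨(hc r h).1.le,
      (hc r h).2.le.trans h.2.le⟩, mem_univ _⟩⟩
  exact (hw.tendsto.comp h3).congr' (hIoo.mono fun r h => hce r h)

section
variable {Ω : Type*} [MeasurableSpace Ω] {α β ν ξ : ℝ} {P : Measure Ω} {X : ℝ≥0 → Ω → ℝ}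

lemma IsForwardSolution.measurable_path (h : IsForwardSolution α β ν ξ P X) (ω : Ω) :
    Measurable fun s : ℝ => X s.toNNReal ω :=
  measurable_of_right_continuous (right_continuous_toNNReal (h.right_continuous ω))

lemma IsForwardSolution.intervalIntegrable (h : IsForwardSolution α β ν ξ P X) {φ : ℝ → ℝ}
    (hφ : IsTestFunction φ) (ω : Ω) (a b : ℝ) :
    IntervalIntegrable (fun s : ℝ => resetGenerator α β ν ξ φ (X s.toNNReal ω)) volume a b := by
  obtain ⟨K, hK⟩ := hφ.exists_bound_resetGenerator α β ν ξ
  have hm := ((hφ.continuous_resetGenerator (α := α) (β := β) (ν := ν) ξ).measurable.comp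
    (h.measurable_path ω))
  exact (intervalIntegrable_const (c := K)).mono_fun hm.aestronglyMeasurable
    (Eventually.of_forall fun s => (hK _).trans (le_abs_self K))

lemma IsForwardSolution.abs_increment_le (h : IsForwardSolution α β ν ξ P X) {φ : ℝ → ℝ}
    (hφ : IsTestFunction φ) {K : ℝ} (hK : ∀ x, |resetGenerator α β ν ξ φ x| ≤ K) (ω : Ω)
    (s r : ℝ) :
    |(∫ v in (0 : ℝ)..r, resetGenerator α β ν ξ φ (X v.toNNReal ω)) -
        ∫ v in (0 : ℝ)..s, resetGenerator α β ν ξ φ (X v.toNNReal ω)| ≤ K * |r - s| := by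
  rw [intervalIntegral.integral_interval_sub_left (h.intervalIntegrable hφ ω _ _)
    (h.intervalIntegrable hφ ω _ _)]
  exact intervalIntegral.norm_integral_le_of_norm_le_const
    (f := fun v => resetGenerator α β ν ξ φ (X v.toNNReal ω)) fun v _ => hK _

variable [IsProbabilityMeasure P]

lemma IsForwardSolution.integrable_comp (h : IsForwardSolution α β ν ξ P X) {φ : ℝ → ℝ}
    (hφ : IsTestFunction φ) (s : ℝ≥0) : Integrable (fun ω => φ (X s ω)) P := by
  obtain ⟨C, hC⟩ := hφ.bound
  exact Integrable.of_bound ((hφ.smooth.continuous.measurable.comp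
    (h.measurable s)).aestronglyMeasurable) C (Eventually.of_forall fun ω => (hC _).1)

lemma IsForwardSolution.integrable_integral (h : IsForwardSolution α β ν ξ P X) {φ : ℝ → ℝ}
    (hφ : IsTestFunction φ) {s : ℝ} (hs : 0 ≤ s) : Integrable
      (fun ω => ∫ r in (0 : ℝ)..s, resetGenerator α β ν ξ φ (X r.toNNReal ω)) P := by
  obtain ⟨K, hK⟩ := hφ.exists_bound_resetGenerator α β ν ξ
  lift s to ℝ≥0 using hs
  exact Integrable.of_bound (h.aestronglyMeasurable φ hφ s) (K * s) (Eventually.of_forall fun ω =>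
      abs_intervalIntegral_le_of_bound (fun s => hK _) s)

/-- The forward equation between two times. -/
lemma IsForwardSolution.sub_eq (h : IsForwardSolution α β ν ξ P X) {φ : ℝ → ℝ}
    (hφ : IsTestFunction φ) {s r : ℝ} (hs : 0 ≤ s) (hr : 0 ≤ r) :
    ∫ ω, φ (X r.toNNReal ω) ∂P - ∫ ω, φ (X s.toNNReal ω) ∂P =
      ∫ ω, ((∫ v in (0 : ℝ)..r, resetGenerator α β ν ξ φ (X v.toNNReal ω)) -
        ∫ v in (0 : ℝ)..s, resetGenerator α β ν ξ φ (X v.toNNReal ω)) ∂P := by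
  rw [integral_sub (h.integrable_integral hφ hr) (h.integrable_integral hφ hs),
    h.forward φ hφ r.toNNReal, h.forward φ hφ s.toNNReal, Real.coe_toNNReal _ hs,
    Real.coe_toNNReal _ hr]
  ring

/-- Along each path the integrand is right continuous, so its primitive has a right derivative; the
increments are bounded by K |r - s|, so dominated convergence takes the expectation. The derivative
is one-sided because the paths are only right continuous. -/
lemma IsForwardSolution.tendsto_slope (h : IsForwardSolution α β ν ξ P X) {φ : ℝ → ℝ}
    (hφ : IsTestFunction φ) {s : ℝ} (hs : 0 ≤ s) :
    Tendsto (fun r : ℝ => (r - s)⁻¹ *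
      (∫ ω, φ (X r.toNNReal ω) ∂P - ∫ ω, φ (X s.toNNReal ω) ∂P)) (𝓝[>] s)
      (𝓝 (∫ ω, resetGenerator α β ν ξ φ (X s.toNNReal ω) ∂P)) := by
  obtain ⟨K, hK⟩ := hφ.exists_bound_resetGenerator α β ν ξ
  have hr : ∀ᶠ r in 𝓝[>] s, s < r := self_mem_nhdsWithin
  have h1 : Tendsto (fun r : ℝ => ∫ ω, (r - s)⁻¹ *
      ((∫ v in (0 : ℝ)..r, resetGenerator α β ν ξ φ (X v.toNNReal ω)) -
        ∫ v in (0 : ℝ)..s, resetGenerator α β ν ξ φ (X v.toNNReal ω)) ∂P) (𝓝[>] s)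
      (𝓝 (∫ ω, resetGenerator α β ν ξ φ (X s.toNNReal ω) ∂P)) := by
    refine tendsto_integral_filter_of_dominated_convergence (fun _ => K) (hr.mono fun r hr => ?_)
      (hr.mono fun r hr => Eventually.of_forall fun ω => ?_) (integrable_const _)
      (Eventually.of_forall fun ω => ?_)
    · exact (((h.integrable_integral hφ (hs.trans hr.le)).sub
        (h.integrable_integral hφ hs)).aestronglyMeasurable).const_mul _
    · have h2 := h.abs_increment_le hφ hK ω s r
      have h3 : 0 < r - s := sub_pos.2 hr
      rw [Real.norm_eq_abs, abs_mul, abs_of_pos (inv_pos.2 h3), inv_mul_le_iff₀ h3]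
      rw [abs_of_pos h3] at h2
      linarith
    · have hc := (hφ.continuous_resetGenerator (α := α) (β := β) (ν := ν) ξ)
      have h2 : HasDerivWithinAt
          (fun r => ∫ v in (0 : ℝ)..r, resetGenerator α β ν ξ φ (X v.toNNReal ω))
          (resetGenerator α β ν ξ φ (X s.toNNReal ω)) (Ici s) s := by
        refine intervalIntegral.integral_hasDerivWithinAt_right (t := Ioi s)
          (h.intervalIntegrable hφ ω _ _) ?_ ?_
        · exact ((hc.measurable.comp
            (h.measurable_path ω)).stronglyMeasurable.stronglyMeasurableAtFilter)
        · exact hc.continuousAt.comp_continuousWithinAt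
            ((right_continuous_toNNReal (h.right_continuous ω) s).mono Ioi_subset_Ici_self)
      have h3 := (hasDerivWithinAt_iff_tendsto_slope' self_notMem_Ioi).1 h2.Ioi_of_Ici
      exact h3
  refine h1.congr' (hr.mono fun r hr => ?_)
  beta_reduce
  rw [integral_const_mul, h.sub_eq hφ hs (hs.trans hr.le)]

/-- **Duhamel's formula**: the one-dimensional laws of a solution of the forward equation, tested
against normal densities of variance `1`. -/
theorem IsForwardSolution.integral_ouTest (h : IsForwardSolution α β ν ξ P X) (hα : 0 < α)
    (hν : 0 < ν) (hξ : 0 ≤ ξ) (z : ℝ) (t : ℝ≥0) :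
    ∫ ω, ouTest α β ν z 0 (X t ω) ∂P =
      Real.exp (-ξ * t) * ∫ ω, ouTest α β ν z t (X 0 ω) ∂P +
        ξ * ∫ r in (0 : ℝ)..t, Real.exp (-ξ * r) * ouTest α β ν z r 0 := by
  obtain ⟨C, hC⟩ := exists_bound_ouTest hα hν β z
  obtain ⟨T, hT⟩ : ∃ T : ℝ, T = t := ⟨_, rfl⟩
  have hT0 : 0 ≤ T := hT ▸ t.2
  set K := (|α| + |α * β| + |1 / 2 * (α * ν)| + 2 * |ξ|) * C
  have hK : ∀ τ, 0 ≤ τ → ∀ x, |resetGenerator α β ν ξ (ouTest α β ν z τ) x| ≤ K := fun τ hτ x =>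
    abs_resetGenerator_le ξ (hC τ hτ 0).1 (hC τ hτ x).1 (hC τ hτ x).2.1 (hC τ hτ x).2.2.1
      (hC τ hτ x).2.2.2
  have hK0 : 0 ≤ K := (abs_nonneg _).trans (hK 0 le_rfl 0)
  have hC0 : 0 ≤ C := (abs_nonneg _).trans (hC 0 le_rfl 0).1
  set e : ℝ → ℝ := fun s => Real.exp (-ξ * (T - s)) with he
  have he0 : ∀ s, 0 < e s := fun s => Real.exp_pos _
  have he1 : ∀ s, s ≤ T → e s ≤ 1 := fun s hs =>
    Real.exp_le_one_iff.2 (by nlinarith [mul_nonneg hξ (sub_nonneg.2 hs)])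
  have hed : ∀ s, HasDerivAt e (e s * ξ) s := fun s => by
    have := (((hasDerivAt_id s).const_sub T).const_mul (-ξ)).exp
    refine this.congr_deriv ?_
    simp [he]
  -- With the evolution run backwards and the integrating factor e, ∂_s u + L u = ξ u(s, 0): the
  -- loss by resetting is absorbed and only the gain at 0 is left.
  set u : ℝ → ℝ → ℝ := fun s x => e s * ouTest α β ν z (T - s) x with hu
  set w : ℝ → ℝ → ℝ := fun s x =>
    -(e s * (resetGenerator α β ν ξ (ouTest α β ν z (T - s)) x - ξ * ouTest α β ν z (T - s) 0))
    with hw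
  have hud : ∀ x, ∀ s ≤ T, HasDerivAt (fun s => u s x) (w s x) s := by
    intro x s hs
    have h1 := (hasDerivAt_ouTest_time (β := β) (z := z) hα hν (sub_nonneg.2 hs) ξ x).comp s
      ((hasDerivAt_id s).const_sub T)
    refine ((hed s).mul h1).congr_deriv ?_
    simp only [hw, Function.comp_apply]
    ring
  have hwb : ∀ s ≤ T, ∀ x, |w s x| ≤ K + ξ * C := by
    intro s hs x
    have h1 := hK _ (sub_nonneg.2 hs) x
    have h2 := (hC _ (sub_nonneg.2 hs) 0).1
    simp only [hw, abs_neg, abs_mul, abs_of_pos (he0 s)]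
    have h3 : |resetGenerator α β ν ξ (ouTest α β ν z (T - s)) x - ξ * ouTest α β ν z (T - s) 0|
        ≤ K + ξ * C := by
      refine (abs_sub _ _).trans (add_le_add h1 ?_)
      rw [abs_mul, abs_of_nonneg hξ]
      gcongr
    have h4 : 0 ≤ K + ξ * C := (abs_nonneg _).trans h3
    calc _ ≤ 1 * (K + ξ * C) := by gcongr; exact he1 s hs
      _ = _ := one_mul _
  have hwc : ContinuousOn (fun p : ℝ × ℝ => w p.1 p.2) (Iic T ×ˢ univ) := by
    have h1 : ContinuousOn (fun p : ℝ × ℝ => resetGenerator α β ν ξ (ouTest α β ν z (T - p.1)) p.2)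
        (Iic T ×ˢ univ) :=
      (continuousOn_resetGenerator_ouTest (β := β) (z := z) hα hν ξ).comp
        (f := fun p : ℝ × ℝ => (T - p.1, p.2)) (by fun_prop)
        fun p hp => ⟨show 0 ≤ T - p.1 from sub_nonneg.2 hp.1, mem_univ _⟩
    have h2 : ContinuousOn (fun p : ℝ × ℝ => ouTest α β ν z (T - p.1) 0) (Iic T ×ˢ univ) :=
      (continuousOn_ouTest (β := β) (z := z) hα hν).comp
        (f := fun p : ℝ × ℝ => (T - p.1, 0)) (by fun_prop)
        fun p hp => ⟨show 0 ≤ T - p.1 from sub_nonneg.2 hp.1, mem_univ _⟩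
    simp only [hw, he]
    fun_prop
  have htest : ∀ s ≤ T, IsTestFunction (ouTest α β ν z (T - s)) := fun s hs =>
    isTestFunction_ouTest hα hν (sub_nonneg.2 hs)
  have hui : ∀ s ≤ T, ∀ r : ℝ≥0, Integrable (fun ω => u s (X r ω)) P := fun s hs r =>
    (h.integrable_comp (htest s hs) r).const_mul _
  have hdiff : ∀ s ≤ T, ∀ r ≤ T, ∀ x, |u r x - u s x| ≤ (K + ξ * C) * |r - s| := by
    intro s hs r hr x
    exact (convex_Iic T).norm_image_sub_le_of_norm_hasDerivWithin_le
      (fun v hv => (hud x v hv).hasDerivWithinAt) (fun v hv => hwb v hv x) hs hr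
  set G : ℝ → ℝ := fun s => ∫ ω, u s (X s.toNNReal ω) ∂P with hG
  -- The increment splits into the change of the function at the later position and the change of
  -- the law for the function frozen at s.
  have hGsub : ∀ s r, s ≤ T → r ≤ T → G r - G s =
      ∫ ω, (u r (X r.toNNReal ω) - u s (X r.toNNReal ω)) ∂P + e s *
        (∫ ω, ouTest α β ν z (T - s) (X r.toNNReal ω) ∂P
          - ∫ ω, ouTest α β ν z (T - s) (X s.toNNReal ω) ∂P) := by
    intro s r hs hr
    rw [integral_sub (hui r hr _) (hui s hs _), mul_sub, ← integral_const_mul, ← integral_const_mul]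
    simp only [hG, hu]
    ring
  have hGc : ContinuousOn G (Icc 0 T) := by
    have hlip : ∀ s ∈ Icc 0 T, ∀ r ∈ Icc 0 T, |G r - G s| ≤ (K + ξ * C + K) * |r - s| := by
      intro s hs r hr
      rw [hGsub s r hs.2 hr.2, add_mul]
      refine (abs_add_le _ _).trans (add_le_add ?_ ?_)
      · have := norm_integral_le_of_norm_le_const (μ := P) (C := (K + ξ * C) * |r - s|)
          (f := fun ω => u r (X r.toNNReal ω) - u s (X r.toNNReal ω))
          (Eventually.of_forall fun ω => hdiff s hs.2 r hr.2 _)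
        simpa using this
      · rw [abs_mul, abs_of_pos (he0 s), h.sub_eq (htest s hs.2) hs.1 hr.1]
        have := norm_integral_le_of_norm_le_const (μ := P) (C := K * |r - s|)
          (f := fun ω => (∫ v in (0 : ℝ)..r, resetGenerator α β ν ξ (ouTest α β ν z (T - s))
              (X v.toNNReal ω)) - ∫ v in (0 : ℝ)..s, resetGenerator α β ν ξ
              (ouTest α β ν z (T - s)) (X v.toNNReal ω))
          (Eventually.of_forall fun ω => h.abs_increment_le (htest s hs.2)
            (hK _ (sub_nonneg.2 hs.2)) ω s r)
        simp only [Real.norm_eq_abs, probReal_univ, mul_one] at this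
        refine (mul_le_mul (he1 s hs.2) this (abs_nonneg _) zero_le_one).trans (by rw [one_mul])
    refine LipschitzOnWith.continuousOn (K := (K + ξ * C + K).toNNReal)
      (LipschitzOnWith.of_dist_le_mul fun r hr s hs => ?_)
    rw [Real.coe_toNNReal _ (by positivity)]
    exact hlip s hs r hr
  -- The two parts of the increment contribute E w and e E L; their generator terms cancel.
  have hGd : ∀ s ∈ Ico 0 T, HasDerivWithinAt G (ξ * u s 0) (Ici s) s := by
    intro s hs
    rw [← hasDerivWithinAt_Ioi_iff_Ici, hasDerivWithinAt_iff_tendsto_slope' self_notMem_Ioi]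
    have hIoo : ∀ᶠ r in 𝓝[>] s, r ∈ Ioo s T := Ioo_mem_nhdsGT hs.2
    have h1 : Tendsto (fun r => ∫ ω, (r - s)⁻¹ *
        (u r (X r.toNNReal ω) - u s (X r.toNNReal ω)) ∂P) (𝓝[>] s)
        (𝓝 (∫ ω, w s (X s.toNNReal ω) ∂P)) := by
      refine tendsto_integral_filter_of_dominated_convergence (fun _ => K + ξ * C)
        (hIoo.mono fun r hr => ?_) (hIoo.mono fun r hr => Eventually.of_forall fun ω => ?_)
        (integrable_const _) (Eventually.of_forall fun ω => ?_)
      · exact (((hui r hr.2.le _).sub (hui s hs.2.le _)).aestronglyMeasurable).const_mul _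
      · have h2 := hdiff s hs.2.le r hr.2.le (X r.toNNReal ω)
        have h3 : 0 < r - s := sub_pos.2 hr.1
        rw [Real.norm_eq_abs, abs_mul, abs_of_pos (inv_pos.2 h3), inv_mul_le_iff₀ h3]
        rw [abs_of_pos h3] at h2
        linarith
      · refine tendsto_slope_along (y := fun r => X r.toNNReal ω) hs.2
          (fun x r hr => hud x r hr.2) ?_ (right_continuous_toNNReal (h.right_continuous ω) s)
        exact (hwc (s, _) ⟨hs.2.le, mem_univ _⟩).mono (prod_mono (fun r hr => hr.2) le_rfl)
    have h2 := (h.tendsto_slope (htest s hs.2.le) hs.1).const_mul (e s)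
    have h3 := h1.add h2
    have h4 : ∫ ω, w s (X s.toNNReal ω) ∂P + e s * ∫ ω, resetGenerator α β ν ξ
        (ouTest α β ν z (T - s)) (X s.toNNReal ω) ∂P = ξ * u s 0 := by
      have hi : Integrable (fun ω => resetGenerator α β ν ξ
          (ouTest α β ν z (T - s)) (X s.toNNReal ω)) P :=
        Integrable.of_bound ((((htest s hs.2.le).continuous_resetGenerator ξ).measurable.comp
          (h.measurable _)).aestronglyMeasurable) K
          (Eventually.of_forall fun ω => hK _ (sub_nonneg.2 hs.2.le) _)
      simp only [hw]
      rw [integral_neg, integral_const_mul, integral_sub hi (integrable_const _), integral_const]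
      simp only [probReal_univ, smul_eq_mul, hu]
      ring
    rw [h4] at h3
    refine h3.congr' (hIoo.mono fun r hr => ?_)
    rw [slope_def_field, div_eq_inv_mul, hGsub s r hs.2.le hr.2.le, integral_const_mul]
    ring
  have hu0 : ContinuousOn (fun s => ξ * u s 0) (Icc 0 T) := by
    have h2 : ContinuousOn (fun s : ℝ => ouTest α β ν z (T - s) 0) (Icc 0 T) :=
      (continuousOn_ouTest (β := β) (z := z) hα hν).comp
        (f := fun s : ℝ => (T - s, (0 : ℝ))) (by fun_prop)
        fun s hs => ⟨show 0 ≤ T - s from sub_nonneg.2 hs.2, mem_univ _⟩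
    simp only [hu, he]
    fun_prop
  have hI : ∀ s ∈ Ico 0 T, HasDerivWithinAt (fun s => G 0 + ∫ r in (0 : ℝ)..s, ξ * u r 0)
      (ξ * u s 0) (Ici s) s := by
    intro s hs
    refine HasDerivWithinAt.const_add _ ?_
    have hii : IntervalIntegrable (fun s => ξ * u s 0) volume 0 s :=
      (hu0.mono (Icc_subset_Icc_right hs.2.le)).intervalIntegrable_of_Icc hs.1
    refine intervalIntegral.integral_hasDerivWithinAt_right (t := Ioi s) hii ?_ ?_
    · refine ⟨Ioo s T, Ioo_mem_nhdsGT hs.2, ?_⟩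
      exact (hu0.mono (fun r hr => ⟨hs.1.trans hr.1.le, hr.2.le⟩)).aestronglyMeasurable
        measurableSet_Ioo
    · exact ((hu0 s ⟨hs.1, hs.2.le⟩).mono_of_mem_nhdsWithin
        (mem_of_superset (Ioo_mem_nhdsGT hs.2) fun r hr => ⟨hs.1.trans hr.1.le, hr.2.le⟩))
  have hIc : ContinuousOn (fun s => G 0 + ∫ r in (0 : ℝ)..s, ξ * u r 0) (Icc 0 T) := by
    refine continuousOn_const.add ?_
    have := intervalIntegral.continuousOn_primitive_interval (μ := volume) (a := 0) (b := T)
      (f := fun r => ξ * u r 0) (by rw [uIcc_of_le hT0]; exact hu0.integrableOn_Icc)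
    rwa [uIcc_of_le hT0] at this
  -- Continuous functions with the same right derivative and the same value at 0 coincide; this is
  -- what the Lipschitz bound for G was for.
  have hfin := eq_of_has_deriv_right_eq hGd hI hGc hIc (by simp) T ⟨hT0, le_rfl⟩
  have hsub : ∫ r in (0 : ℝ)..T, ξ * u r 0 =
      ξ * ∫ r in (0 : ℝ)..T, Real.exp (-ξ * r) * ouTest α β ν z r 0 := by
    rw [intervalIntegral.integral_const_mul]
    congr 1
    have := intervalIntegral.integral_comp_sub_left (a := 0) (b := T)
      (fun r => Real.exp (-ξ * r) * ouTest α β ν z r 0) T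
    simpa [hu, he] using this
  rw [hsub] at hfin
  simp only [hG, hu, he, sub_self, mul_zero, Real.exp_zero, one_mul, sub_zero,
    Real.toNNReal_zero, integral_const_mul] at hfin
  rw [← hT, ← hfin, hT, Real.toNNReal_coe]

end

/-! ### The Ornstein-Uhlenbeck density -/

section
variable {α β ν ξ : ℝ}

lemma variance_pos (hα : 0 < α) (hν : 0 < ν) {t : ℝ} (ht : 0 < t) :
    0 < ν / 2 * (1 - Real.exp (-2 * α * t)) := by
  have : Real.exp (-2 * α * t) < 1 := by
    rw [Real.exp_lt_one_iff]; nlinarith [mul_pos hα ht]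
  have : 0 < 1 - Real.exp (-2 * α * t) := by linarith
  positivity

lemma ouDensity_eq_heatKernel (hα : 0 < α) (hν : 0 < ν) {t : ℝ} (ht : 0 < t) (x y : ℝ) :
    ouDensity α β ν x t y = heatKernel (ν / 2 * (1 - Real.exp (-2 * α * t)))
      (x - (β * (1 - Real.exp (-α * t)) + y * Real.exp (-α * t))) := by
  rw [ouDensity, gaussianPDFReal_eq_heatKernel, Real.coe_toNNReal _ (variance_pos hα hν ht).le]

lemma ouDensity_nonneg (x t y : ℝ) : 0 ≤ ouDensity α β ν x t y := gaussianPDFReal_nonneg _ _ _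

lemma ouDensity_neg (x t y : ℝ) : ouDensity α (-β) ν (-x) t (-y) = ouDensity α β ν x t y := by
  simp only [ouDensity, gaussianPDFReal_eq_heatKernel]
  rw [← heatKernel_neg]
  congr 1
  ring

lemma continuous_ouDensity (hα : 0 < α) (hν : 0 < ν) {t : ℝ} (ht : 0 < t) (y : ℝ) :
    Continuous (fun x => ouDensity α β ν x t y) := by
  simp_rw [ouDensity_eq_heatKernel hα hν ht]
  exact Continuous.heatKernel (by fun_prop) (by fun_prop) fun _ => variance_pos hα hν ht

lemma measurable_ouDensity (y : ℝ) : Measurable (fun p : ℝ × ℝ => ouDensity α β ν p.2 p.1 y) := by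
  unfold ouDensity gaussianPDFReal
  fun_prop

lemma integrable_ouDensity (t y : ℝ) : Integrable (fun x => ouDensity α β ν x t y) :=
  integrable_gaussianPDFReal _ _

lemma integral_ouDensity (hα : 0 < α) (hν : 0 < ν) {t : ℝ} (ht : 0 < t) (y : ℝ) :
    ∫ x, ouDensity α β ν x t y = 1 := by
  simp_rw [ouDensity_eq_heatKernel hα hν ht]
  exact integral_heatKernel (variance_pos hα hν ht) _

lemma integral_heatKernel_mul_ouDensity (hα : 0 < α) (hν : 0 < ν) {t : ℝ} (ht : 0 < t)
    (y z : ℝ) : ∫ x, heatKernel 1 (z - x) * ouDensity α β ν x t y = ouTest α β ν z t y := by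
  simp_rw [ouDensity_eq_heatKernel hα hν ht]
  exact integral_heatKernel_mul (variance_pos hα hν ht) _ _

/-- A bound for the transition density that is integrable in time near `0`. -/
lemma ouDensity_le (hα : 0 < α) (hν : 0 < ν) {t : ℝ} (ht : 0 < t) (x y : ℝ) :
    ouDensity α β ν x t y ≤
      (Real.sqrt (Real.pi * ν))⁻¹ * (1 + (Real.sqrt (2 * α))⁻¹) * (1 + t ^ (-(1 / 2) : ℝ)) := by
  rw [ouDensity_eq_heatKernel hα hν ht]
  refine (heatKernel_le _ (variance_pos hα hν ht) _).trans ?_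
  have hx : 0 < 2 * α * t := by positivity
  have h1 : 2 * Real.pi * (ν / 2 * (1 - Real.exp (-2 * α * t))) =
    (Real.pi * ν) * (1 - Real.exp (-(2 * α * t))) := by
      rw [show -2 * α * t = -(2 * α * t) by ring]; ring
  rw [h1, Real.sqrt_mul (by positivity), mul_inv,
    mul_assoc (Real.sqrt (Real.pi * ν))⁻¹]
  refine mul_le_mul_of_nonneg_left ?_ (by positivity)
  -- With v = 2αt, e^v ≥ 1 + v gives this bound, so (1 - e^{-v})^{-1/2} ≤ √(1 + v)/√v ≤ 1 + 1/√v;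
  -- the result is then split into a constant and a factor in t.
  have h2 : 2 * α * t / (1 + 2 * α * t) ≤ 1 - Real.exp (-(2 * α * t)) := by
    rw [Real.exp_neg]
    have h3 : (Real.exp (2 * α * t))⁻¹ ≤ (1 + 2 * α * t)⁻¹ := by
      gcongr
      linarith [Real.add_one_le_exp (2 * α * t)]
    have h4 : 2 * α * t / (1 + 2 * α * t) = 1 - (1 + 2 * α * t)⁻¹ := by field_simp; ring
    linarith
  have h5 : (Real.sqrt (1 - Real.exp (-(2 * α * t))))⁻¹ ≤
      (Real.sqrt (2 * α * t / (1 + 2 * α * t)))⁻¹ := by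
    gcongr
  have h6 : t ^ (-(1 / 2) : ℝ) = (Real.sqrt t)⁻¹ := by
    rw [Real.rpow_neg ht.le, Real.sqrt_eq_rpow]
  refine h5.trans ?_
  rw [h6, Real.sqrt_div hx.le, inv_div, Real.sqrt_mul (by positivity : (0 : ℝ) ≤ 2 * α)]
  have hp : 0 < Real.sqrt (2 * α) := by positivity
  have hq : 0 < Real.sqrt t := by positivity
  have h7 : Real.sqrt (1 + 2 * α * t) ≤ 1 + Real.sqrt (2 * α) * Real.sqrt t := by
    rw [Real.sqrt_le_left (by positivity), ← Real.sqrt_mul (by positivity)]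
    nlinarith [Real.sq_sqrt hx.le, Real.sqrt_nonneg (2 * α * t)]
  rw [div_le_iff₀ (by positivity)]
  refine h7.trans ?_
  have : (1 + (Real.sqrt (2 * α))⁻¹) * (1 + (Real.sqrt t)⁻¹) *
      (Real.sqrt (2 * α) * Real.sqrt t) =
      (Real.sqrt (2 * α) + 1) * (Real.sqrt t + 1) := by field_simp
  rw [this]
  nlinarith

lemma tendsto_ouDensity (hα : 0 < α) (hν : 0 < ν) (x y : ℝ) :
    Tendsto (fun t : ℝ => ouDensity α β ν x t y) atTop (𝓝 (ouSteadyDensity β ν x)) := by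
  have he : ∀ c : ℝ, 0 < c → Tendsto (fun t : ℝ => Real.exp (-c * t)) atTop (𝓝 0) := by
    intro c hc
    exact Real.tendsto_exp_atBot.comp (tendsto_id.const_mul_atTop_of_neg (neg_lt_zero.2 hc))
  have h1 := he α hα
  have h2 : Tendsto (fun t : ℝ => Real.exp (-2 * α * t)) atTop (𝓝 0) := by
    have := he (2 * α) (by positivity)
    simpa only [neg_mul] using this
  have h3 : Tendsto (fun t : ℝ => heatKernel (ν / 2 * (1 - Real.exp (-2 * α * t)))
      (x - (β * (1 - Real.exp (-α * t)) + y * Real.exp (-α * t)))) atTop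
      (𝓝 (heatKernel (ν / 2 * (1 - 0)) (x - (β * (1 - 0) + y * 0)))) := by
    have hV : Tendsto (fun t : ℝ => ν / 2 * (1 - Real.exp (-2 * α * t))) atTop
      (𝓝 (ν / 2 * (1 - 0))) := (h2.const_sub 1).const_mul _
    have hd : Tendsto (fun t : ℝ => x - (β * (1 - Real.exp (-α * t)) + y * Real.exp (-α * t)))
      atTop (𝓝 (x - (β * (1 - 0) + y * 0))) :=
        (((h1.const_sub 1).const_mul _).add (h1.const_mul _)).const_sub _
    unfold heatKernel
    refine Tendsto.mul (Tendsto.inv₀ ((hV.const_mul _).sqrt) ?_)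
      ((Real.continuous_exp.tendsto _).comp
      (Tendsto.div (hd.pow 2).neg (hV.const_mul 2) ?_))
    · simp only [sub_zero, mul_one]; positivity
    · simp only [sub_zero, mul_one]; positivity
  have h4 : heatKernel (ν / 2 * (1 - 0)) (x - (β * (1 - 0) + y * 0)) = ouSteadyDensity β ν x := by
    unfold heatKernel ouSteadyDensity
    rw [one_div]
    congr 3 <;> ring
  rw [h4] at h3
  refine h3.congr' ((eventually_gt_atTop 0).mono fun t ht => ?_)
  exact (ouDensity_eq_heatKernel hα hν ht x y).symm

/-! ### Mixtures over an exponential time -/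

/-- The density of the Ornstein-Uhlenbeck process started at `0`, integrated over times in `S`
with weight `exp (-ξ r)`. -/
noncomputable def ouMixture (α β ν ξ : ℝ) (S : Set ℝ) (w : ℝ) : ℝ :=
  ∫ r in S, Real.exp (-ξ * r) * ouDensity α β ν w r 0

lemma integrableOn_weight_Ioi (hξ : 0 < ξ) :
    IntegrableOn (fun r : ℝ => Real.exp (-ξ * r) * (1 + r ^ (-(1 / 2) : ℝ))) (Ioi 0) := by
  have h1 : IntegrableOn (fun r : ℝ => Real.exp (-ξ * r)) (Ioi 0) := by
    simpa using integrableOn_exp_mul_Ioi (neg_lt_zero.2 hξ) 0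
  have h2 := integrableOn_rpow_mul_exp_neg_mul_rpow (p := 1) (s := -(1 / 2)) (b := ξ)
    (by norm_num) zero_lt_one hξ
  refine (h1.add h2).congr_fun (fun r _ => ?_) measurableSet_Ioi
  simp
  ring

/-- On a bounded time interval ξ = 0 is allowed, so the process without resetting is covered by the
same formulas. -/
lemma integrableOn_weight_Ioc (hξ : 0 ≤ ξ) (t : ℝ) :
    IntegrableOn (fun r : ℝ => Real.exp (-ξ * r) * (1 + r ^ (-(1 / 2) : ℝ))) (Ioc 0 t) := by
  have h1 : IntegrableOn (fun r : ℝ => 1 + r ^ (-(1 / 2) : ℝ)) (Ioc 0 t) := by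
    refine Integrable.add (integrable_const _) ?_
    rcases le_or_gt t 0 with ht | ht
    · rw [Ioc_eq_empty (not_lt.2 ht)]; exact integrableOn_empty
    · exact ((intervalIntegral.intervalIntegrable_rpow' (by norm_num)).1)
  refine Integrable.mono' h1 (by fun_prop) ?_
  refine (ae_restrict_mem measurableSet_Ioc).mono fun r hr => ?_
  have h2 : Real.exp (-ξ * r) ≤ 1 := Real.exp_le_one_iff.2 (by nlinarith [hr.1])
  have h3 : 0 ≤ r ^ (-(1 / 2) : ℝ) := Real.rpow_nonneg hr.1.le _
  rw [Real.norm_eq_abs, abs_of_nonneg (by positivity)]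
  exact mul_le_of_le_one_left (by positivity) h2

lemma ouMixture_nonneg (S : Set ℝ) (w : ℝ) : 0 ≤ ouMixture α β ν ξ S w :=
  integral_nonneg fun _ => mul_nonneg (Real.exp_pos _).le (ouDensity_nonneg _ _ _)

variable {S : Set ℝ}

lemma ae_weight_mul_ouDensity_le (hα : 0 < α) (hν : 0 < ν) (hS : S ⊆ Ioi 0)
    (hSm : MeasurableSet S) (w : ℝ) : ∀ᵐ r ∂(volume.restrict S),
      ‖Real.exp (-ξ * r) * ouDensity α β ν w r 0‖ ≤
      (Real.sqrt (Real.pi * ν))⁻¹ * (1 + (Real.sqrt (2 * α))⁻¹) *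
        (Real.exp (-ξ * r) * (1 + r ^ (-(1 / 2) : ℝ))) := by
  refine (ae_restrict_mem hSm).mono fun r hr => ?_
  rw [Real.norm_eq_abs, abs_of_nonneg (mul_nonneg (Real.exp_pos _).le (ouDensity_nonneg _ _ _))]
  have := ouDensity_le (β := β) hα hν (hS hr) w 0
  calc _ ≤ Real.exp (-ξ * r) * _ := mul_le_mul_of_nonneg_left this (Real.exp_pos _).le
    _ = _ := by ring

lemma aestronglyMeasurable_weight_mul_ouDensity (w : ℝ) : AEStronglyMeasurable
    (fun r => Real.exp (-ξ * r) * ouDensity α β ν w r 0) (volume.restrict S) :=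
  (Measurable.mul (by fun_prop) ((measurable_ouDensity 0).comp
    (measurable_id.prodMk measurable_const))).aestronglyMeasurable

lemma integrableOn_weight_mul_ouDensity (hα : 0 < α) (hν : 0 < ν) (hS : S ⊆ Ioi 0)
    (hSm : MeasurableSet S)
    (hSi : IntegrableOn (fun r : ℝ => Real.exp (-ξ * r) * (1 + r ^ (-(1 / 2) : ℝ))) S) (w : ℝ) :
    IntegrableOn (fun r => Real.exp (-ξ * r) * ouDensity α β ν w r 0) S :=
  Integrable.mono' (hSi.const_mul _) (aestronglyMeasurable_weight_mul_ouDensity w)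
    (ae_weight_mul_ouDensity_le hα hν hS hSm w)

lemma continuous_ouMixture (hα : 0 < α) (hν : 0 < ν) (hS : S ⊆ Ioi 0) (hSm : MeasurableSet S)
    (hSi : IntegrableOn (fun r : ℝ => Real.exp (-ξ * r) * (1 + r ^ (-(1 / 2) : ℝ))) S) :
    Continuous (ouMixture α β ν ξ S) := by
  refine continuous_of_dominated (fun w => aestronglyMeasurable_weight_mul_ouDensity w)
    (fun w => ae_weight_mul_ouDensity_le hα hν hS hSm w) (hSi.const_mul _) ?_
  refine (ae_restrict_mem hSm).mono fun r hr => ?_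
  exact continuous_const.mul (continuous_ouDensity hα hν (hS hr) 0)

lemma integrableOn_exp_of_weight (hS : S ⊆ Ioi 0) (hSm : MeasurableSet S)
    (hSi : IntegrableOn (fun r : ℝ => Real.exp (-ξ * r) * (1 + r ^ (-(1 / 2) : ℝ))) S) :
    IntegrableOn (fun r : ℝ => Real.exp (-ξ * r)) S := by
  refine Integrable.mono' hSi (by fun_prop) ((ae_restrict_mem hSm).mono fun r hr => ?_)
  have h3 : 0 ≤ r ^ (-(1 / 2) : ℝ) := Real.rpow_nonneg (hS hr).le _
  rw [Real.norm_eq_abs, abs_of_pos (Real.exp_pos _)]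
  exact le_mul_of_one_le_right (Real.exp_pos _).le (by linarith)

lemma integrable_prod_ouMixture (hα : 0 < α) (hν : 0 < ν) (hS : S ⊆ Ioi 0)
    (hSm : MeasurableSet S)
    (hSi : IntegrableOn (fun r : ℝ => Real.exp (-ξ * r) * (1 + r ^ (-(1 / 2) : ℝ))) S)
    {g : ℝ → ℝ} (hg : Measurable g) {C : ℝ} (hC : ∀ w, |g w| ≤ C) :
    Integrable (fun p : ℝ × ℝ => g p.2 * (Real.exp (-ξ * p.1) * ouDensity α β ν p.2 p.1 0))
      ((volume.restrict S).prod volume) := by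
  have hi : Integrable (fun p : ℝ × ℝ => Real.exp (-ξ * p.1) * ouDensity α β ν p.2 p.1 0)
      ((volume.restrict S).prod volume) := by
    have hm : Measurable
        (fun p : ℝ × ℝ => Real.exp (-ξ * p.1) * ouDensity α β ν p.2 p.1 0) :=
      Measurable.mul (by fun_prop) (measurable_ouDensity 0)
    rw [integrable_prod_iff hm.aestronglyMeasurable]
    refine ⟨Eventually.of_forall fun r => (integrable_ouDensity r 0).const_mul (Real.exp (-ξ * r)),
      ?_⟩
    refine (integrableOn_exp_of_weight hS hSm hSi).congr
      ((ae_restrict_mem hSm).mono fun r hr => ?_)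
    have h1 : ∀ w, ‖Real.exp (-ξ * r) * ouDensity α β ν w r 0‖ =
      Real.exp (-ξ * r) * ouDensity α β ν w r 0 := fun w => by
        rw [Real.norm_eq_abs,
          abs_of_nonneg (mul_nonneg (Real.exp_pos _).le (ouDensity_nonneg _ _ _))]
    simp only [h1]
    rw [integral_const_mul, integral_ouDensity hα hν (hS hr), mul_one]
  exact hi.bdd_mul (hg.comp measurable_snd).aestronglyMeasurable
    (Eventually.of_forall fun p => hC p.2)

/-- Fubini's theorem. With g = 1 it gives the total mass, with g a heat kernel the integral in
Duhamel's formula. -/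
lemma integral_mul_ouMixture (hα : 0 < α) (hν : 0 < ν) (hS : S ⊆ Ioi 0)
    (hSm : MeasurableSet S)
    (hSi : IntegrableOn (fun r : ℝ => Real.exp (-ξ * r) * (1 + r ^ (-(1 / 2) : ℝ))) S)
    {g : ℝ → ℝ} (hg : Measurable g) {C : ℝ} (hC : ∀ w, |g w| ≤ C) :
    Integrable (fun w => g w * ouMixture α β ν ξ S w) ∧
    ∫ w, g w * ouMixture α β ν ξ S w =
      ∫ r in S, Real.exp (-ξ * r) * ∫ w, g w * ouDensity α β ν w r 0 := by
  have h := integrable_prod_ouMixture (β := β) hα hν hS hSm hSi hg hC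
  have h1 : ∀ w, g w * ouMixture α β ν ξ S w =
      ∫ r in S, g w * (Real.exp (-ξ * r) * ouDensity α β ν w r 0) := fun w => by
    rw [ouMixture, integral_const_mul]
  simp_rw [h1]
  refine ⟨h.integral_prod_right, ?_⟩
  rw [← integral_integral_swap h]
  refine integral_congr_ae (Eventually.of_forall fun r => ?_)
  beta_reduce
  rw [← integral_const_mul]
  congr 1 with w
  ring

lemma integrable_ouMixture (hα : 0 < α) (hν : 0 < ν) (hS : S ⊆ Ioi 0) (hSm : MeasurableSet S)
    (hSi : IntegrableOn (fun r : ℝ => Real.exp (-ξ * r) * (1 + r ^ (-(1 / 2) : ℝ))) S) :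
    Integrable (ouMixture α β ν ξ S) := by
  simpa using (integral_mul_ouMixture (β := β) hα hν hS hSm hSi (g := fun _ => 1)
    measurable_const (C := 1) (by simp)).1

lemma integral_heatKernel_mul_ouMixture (hα : 0 < α) (hν : 0 < ν) (hS : S ⊆ Ioi 0)
    (hSm : MeasurableSet S)
    (hSi : IntegrableOn (fun r : ℝ => Real.exp (-ξ * r) * (1 + r ^ (-(1 / 2) : ℝ))) S) (z : ℝ) :
    Integrable (fun w => heatKernel 1 (z - w) * ouMixture α β ν ξ S w) ∧
    ∫ w, heatKernel 1 (z - w) * ouMixture α β ν ξ S w =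
      ∫ r in S, Real.exp (-ξ * r) * ouTest α β ν z r 0 := by
  obtain ⟨h1, h2⟩ := integral_mul_ouMixture (β := β) hα hν hS hSm hSi
    (g := fun w => heatKernel 1 (z - w))
    (Continuous.heatKernel (by fun_prop) (by fun_prop) fun _ => zero_lt_one).measurable (C := 1)
    (fun w => by rw [abs_of_nonneg (heatKernel_nonneg _ _)]; exact heatKernel_le_one le_rfl _)
  refine ⟨h1, h2.trans (setIntegral_congr_fun hSm fun r hr => ?_)⟩
  rw [integral_heatKernel_mul_ouDensity hα hν (hS hr)]

/-! ### The steady-state density -/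

lemma steadyDensity_eq_ouMixture (x : ℝ) :
    steadyDensity α β ν ξ x = ξ * ouMixture α β ν ξ (Ioi 0) x := rfl

lemma steadyDensity_nonneg (hξ : 0 < ξ) (x : ℝ) : 0 ≤ steadyDensity α β ν ξ x :=
  mul_nonneg hξ.le (ouMixture_nonneg _ _)

lemma continuous_steadyDensity (hα : 0 < α) (hν : 0 < ν) (hξ : 0 < ξ) :
    Continuous (steadyDensity α β ν ξ) :=
  continuous_const.mul
    (continuous_ouMixture hα hν le_rfl measurableSet_Ioi (integrableOn_weight_Ioi hξ))

lemma integrable_steadyDensity (hα : 0 < α) (hν : 0 < ν) (hξ : 0 < ξ) :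
    Integrable (steadyDensity α β ν ξ) :=
  (integrable_ouMixture hα hν le_rfl measurableSet_Ioi (integrableOn_weight_Ioi hξ)).const_mul ξ

lemma integral_steadyDensity (hα : 0 < α) (hν : 0 < ν) (hξ : 0 < ξ) :
    ∫ x, steadyDensity α β ν ξ x = 1 := by
  have h := (integral_mul_ouMixture (β := β) hα hν le_rfl measurableSet_Ioi
    (integrableOn_weight_Ioi hξ) (g := fun _ => 1) measurable_const (C := 1) (by simp)).2
  simp only [one_mul] at h
  simp_rw [steadyDensity_eq_ouMixture]
  rw [integral_const_mul, h, setIntegral_congr_fun (g := fun r => Real.exp (-ξ * r))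
    measurableSet_Ioi (fun r hr => by
      simp only [integral_ouDensity hα hν (show 0 < r from hr), mul_one])]
  rw [integral_exp_mul_Ioi (neg_lt_zero.2 hξ)]
  field_simp
  simp

lemma steadyDensity_neg (x : ℝ) : steadyDensity α (-β) ν ξ (-x) = steadyDensity α β ν ξ x := by
  have h : ∀ t, ouDensity α (-β) ν (-x) t 0 = ouDensity α β ν x t 0 := fun t => by
    simpa using ouDensity_neg (α := α) (β := β) (ν := ν) x t 0
  simp only [steadyDensity, ouLaplace, h]

/-- The substitution u = ξt turns W into the average of f̃(x, u/ξ | 0) over a unit exponential time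
u, and u/ξ → ∞. For ξ < 1 one has (u/ξ)^{-1/2} ≤ u^{-1/2}, so the density bound dominates uniformly
in ξ. -/
lemma tendsto_steadyDensity (hα : 0 < α) (hν : 0 < ν) (x : ℝ) :
    Tendsto (fun ξ : ℝ => steadyDensity α β ν ξ x) (𝓝[>] 0) (𝓝 (ouSteadyDensity β ν x)) := by
  have hsubst : ∀ ξ : ℝ, 0 < ξ → steadyDensity α β ν ξ x =
      ∫ u in Ioi (0 : ℝ), Real.exp (-1 * u) * ouDensity α β ν x (u / ξ) 0 := by
    intro ξ hξ
    have := integral_comp_mul_left_Ioi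
      (fun u => Real.exp (-1 * u) * ouDensity α β ν x (u / ξ) 0) 0 hξ
    rw [mul_zero, smul_eq_mul, inv_mul_eq_div, eq_div_iff hξ.ne'] at this
    rw [← this, steadyDensity, ouLaplace, mul_comm]
    congr 2
    ext t
    rw [mul_div_cancel_left₀ _ hξ.ne']
    congr 2
    ring
  have hξ : ∀ᶠ ξ : ℝ in 𝓝[>] 0, ξ ∈ Ioo 0 1 := Ioo_mem_nhdsGT zero_lt_one
  have hlim : ouSteadyDensity β ν x =
      ∫ u in Ioi (0 : ℝ), Real.exp (-1 * u) * ouSteadyDensity β ν x := by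
    rw [integral_mul_const, integral_exp_mul_Ioi (by norm_num)]
    simp
  rw [hlim]
  refine Tendsto.congr' (hξ.mono fun ξ h => (hsubst ξ h.1).symm) ?_
  refine tendsto_integral_filter_of_dominated_convergence
    (fun u => (Real.sqrt (Real.pi * ν))⁻¹ * (1 + (Real.sqrt (2 * α))⁻¹) *
        (Real.exp (-1 * u) * (1 + u ^ (-(1 / 2) : ℝ))))
    (hξ.mono fun ξ _ => ?_) (hξ.mono fun ξ h => ?_)
    ((integrableOn_weight_Ioi zero_lt_one).const_mul _) ?_
  · exact (Measurable.mul (by fun_prop) ((measurable_ouDensity 0).comp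
      ((measurable_id.div_const ξ).prodMk measurable_const))).aestronglyMeasurable
  · refine (ae_restrict_mem measurableSet_Ioi).mono fun u hu => ?_
    have hu : 0 < u := hu
    rw [Real.norm_eq_abs, abs_of_nonneg (mul_nonneg (Real.exp_pos _).le (ouDensity_nonneg _ _ _))]
    have h1 := ouDensity_le (β := β) hα hν (div_pos hu h.1) x 0
    have h2 : (u / ξ) ^ (-(1 / 2) : ℝ) ≤ u ^ (-(1 / 2) : ℝ) :=
      Real.rpow_le_rpow_of_nonpos hu (by rw [le_div_iff₀ h.1]; nlinarith [h.2]) (by norm_num)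
    calc _ ≤ Real.exp (-1 * u) * ((Real.sqrt (Real.pi * ν))⁻¹ * (1 + (Real.sqrt (2 * α))⁻¹) *
          (1 + u ^ (-(1 / 2) : ℝ))) := by
            refine mul_le_mul_of_nonneg_left (h1.trans ?_) (Real.exp_pos _).le
            gcongr
      _ = _ := by ring
  · refine (ae_restrict_mem measurableSet_Ioi).mono fun u hu => ?_
    have hu : 0 < u := hu
    have hdiv : Tendsto (fun ξ : ℝ => u / ξ) (𝓝[>] 0) atTop := by
      simp_rw [div_eq_mul_inv]
      exact tendsto_inv_nhdsGT_zero.const_mul_atTop hu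
    exact Tendsto.const_mul _ ((tendsto_ouDensity hα hν x 0).comp hdiv)

end

/-! ### Identification of the laws -/

lemma continuous_heatKernel_one_sub (z : ℝ) : Continuous fun x => heatKernel 1 (z - x) :=
  Continuous.heatKernel (by fun_prop) (by fun_prop) fun _ => zero_lt_one

lemma norm_heatKernel_one_le (d : ℝ) : ‖heatKernel 1 d‖ ≤ 1 := by
  rw [Real.norm_eq_abs, abs_of_nonneg (heatKernel_nonneg _ _)]
  exact heatKernel_le_one le_rfl d

/-- Fubini's theorem: the Fourier transform of a convolution is a product. What matters is that the
Gaussian factor never vanishes and can be cancelled. -/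
lemma integral_cexp_mul_integral_heatKernel (μ : Measure ℝ) [IsFiniteMeasure μ] (s : ℝ) :
    ∫ z : ℝ, Complex.exp (s * z * Complex.I) * ((∫ x, heatKernel 1 (z - x) ∂μ : ℝ) : ℂ) =
      Complex.exp (-(s ^ 2 / 2)) * charFun μ s := by
  have hk : Continuous fun p : ℝ × ℝ => heatKernel 1 (p.1 - p.2) :=
    Continuous.heatKernel (by fun_prop) (by fun_prop) fun _ => zero_lt_one
  have hi : Integrable (fun p : ℝ × ℝ => heatKernel 1 (p.1 - p.2)) (volume.prod μ) := by
    rw [integrable_prod_iff' hk.aestronglyMeasurable]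
    refine ⟨Eventually.of_forall fun x => integrable_heatKernel zero_lt_one x, ?_⟩
    have h1 : ∀ x : ℝ, ∫ z, ‖heatKernel 1 (z - x)‖ = 1 := fun x => by
      simp_rw [Real.norm_eq_abs, abs_of_nonneg (heatKernel_nonneg _ _)]
      exact integral_heatKernel zero_lt_one x
    simp only [h1]
    exact integrable_const 1
  have hi2 : Integrable (fun p : ℝ × ℝ => Complex.exp (s * p.1 * Complex.I) *
      ((heatKernel 1 (p.1 - p.2) : ℝ) : ℂ)) (volume.prod μ) := by
    refine hi.ofReal.bdd_mul (c := 1) (by fun_prop) (Eventually.of_forall fun p => ?_)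
    rw [← Complex.ofReal_mul, Complex.norm_exp_ofReal_mul_I]
  have h2 : ∀ z : ℝ, Complex.exp (s * z * Complex.I) * ((∫ x, heatKernel 1 (z - x) ∂μ : ℝ) : ℂ) =
      ∫ x, Complex.exp (s * z * Complex.I) * ((heatKernel 1 (z - x) : ℝ) : ℂ) ∂μ := fun z => by
    rw [integral_const_mul, integral_complex_ofReal]
  simp_rw [h2]
  rw [integral_integral_swap hi2, charFun_apply_real, ← integral_const_mul]
  congr 1 with x
  have h3 := charFun_gaussianReal (μ := x) (v := 1) s
  rw [charFun_apply_real, integral_gaussianReal_eq_integral_smul one_ne_zero] at h3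
  simp only [gaussianPDFReal_eq_heatKernel, NNReal.coe_one, Complex.real_smul] at h3
  simp_rw [mul_comm (Complex.exp (_ * _ * Complex.I))]
  rw [h3, ← Complex.exp_add]
  congr 1
  push_cast
  ring

/-- A finite measure is determined by its convolution with the standard normal density. -/
lemma measure_eq_of_integral_heatKernel_eq {μ κ : Measure ℝ} [IsFiniteMeasure μ]
    [IsFiniteMeasure κ]
    (h : ∀ z, ∫ x, heatKernel 1 (z - x) ∂μ = ∫ x, heatKernel 1 (z - x) ∂κ) : μ = κ := by
  refine Measure.ext_of_charFun (funext fun s => ?_)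
  have h1 := integral_cexp_mul_integral_heatKernel μ s
  simp_rw [h] at h1
  rw [integral_cexp_mul_integral_heatKernel κ s] at h1
  exact (mul_left_cancel₀ (Complex.exp_ne_zero _) h1).symm

lemma integral_withDensity_ofReal {f : ℝ → ℝ} (hf : Continuous f) (hf0 : ∀ x, 0 ≤ f x)
    (g : ℝ → ℝ) : ∫ x, g x ∂(volume.withDensity fun x => ENNReal.ofReal (f x)) =
      ∫ x, g x * f x := by
  rw [integral_withDensity_eq_integral_toReal_smul (by fun_prop) (by simp)]
  congr 1 with x
  rw [ENNReal.toReal_ofReal (hf0 x), smul_eq_mul, mul_comm]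

lemma isFiniteMeasure_withDensity_of_integrable {f : ℝ → ℝ} (hf : Integrable f) :
    IsFiniteMeasure (volume.withDensity fun x => ENNReal.ofReal (f x)) :=
  isFiniteMeasure_withDensity_ofReal hf.2

/-- A random variable that agrees with a continuous density on all normal densities of variance
`1` has this density. -/
lemma hasDerivAt_measureReal_le {Ω : Type*} [MeasurableSpace Ω] {P : Measure Ω}
    [IsProbabilityMeasure P] {Y : Ω → ℝ} (hY : Measurable Y) {f : ℝ → ℝ} (hf : Continuous f)
    (hf0 : ∀ x, 0 ≤ f x) (hfi : Integrable f)
    (h : ∀ z, ∫ ω, heatKernel 1 (z - Y ω) ∂P = ∫ x, heatKernel 1 (z - x) * f x) (x : ℝ) :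
    HasDerivAt (fun x => P.real {ω | Y ω ≤ x}) (f x) x := by
  have := isFiniteMeasure_withDensity_of_integrable hfi
  have hlaw : P.map Y = volume.withDensity fun x => ENNReal.ofReal (f x) := by
    have := Measure.isProbabilityMeasure_map (μ := P) hY.aemeasurable
    refine measure_eq_of_integral_heatKernel_eq fun z => ?_
    rw [integral_map hY.aemeasurable
      (continuous_heatKernel_one_sub z).measurable.aestronglyMeasurable, h,
      integral_withDensity_ofReal hf hf0]
  have h1 : ∀ x, P.real {ω | Y ω ≤ x} = ∫ w in Iic x, f w := by
    intro x
    have h2 : P.real {ω | Y ω ≤ x} = (P.map Y).real (Iic x) := by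
      rw [map_measureReal_apply hY measurableSet_Iic]; rfl
    rw [h2, hlaw, measureReal_def, withDensity_apply _ measurableSet_Iic,
      integral_eq_lintegral_of_nonneg_ae (Eventually.of_forall hf0)
        hf.aestronglyMeasurable]
  -- A primitive with a fixed base point; continuity of f makes it differentiable at every x, not
  -- merely at almost every x.
  have h3 : (fun x => P.real {ω | Y ω ≤ x}) =
      fun x => (∫ w in Iic 0, f w) + ∫ w in (0 : ℝ)..x, f w := by
    ext x
    rw [h1, ← intervalIntegral.integral_Iic_sub_Iic hfi.integrableOn hfi.integrableOn]
    ring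
  rw [h3]
  exact (hf.integral_hasStrictDerivAt 0 x).hasDerivAt.const_add _

lemma ouTest_zero (α β ν z x : ℝ) : ouTest α β ν z 0 x = heatKernel 1 (z - x) := by
  simp [ouTest]

/-! ### The density with resetting, its limit, and a weak characterisation of the limit -/

section
variable {α β ν ξ y : ℝ}

/-- The transition density of the Ornstein-Uhlenbeck process with resetting: either there was no
resetting before time `t`, or the last one occurred a time `r` before `t`. -/
theorem IsResetOU.hasDerivAt_distFun {Ω : Type*} [mΩ : MeasurableSpace Ω] {P : Measure Ω}
    [IsProbabilityMeasure P] {ℱ : Filtration ℝ≥0 mΩ} {X : ℝ≥0 → Ω → ℝ} (hα : 0 < α) (hν : 0 < ν)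
    (hξ : 0 ≤ ξ) (h : IsResetOU α β ν ξ y P ℱ X) {t : ℝ≥0} (ht : 0 < t) (x : ℝ) :
    HasDerivAt (distFun P X t)
      (Real.exp (-ξ * t) * ouDensity α β ν x t y + ξ * ouMixture α β ν ξ (Ioc 0 (t : ℝ)) x) x := by
  have ht' : (0 : ℝ) < t := ht
  have hw := integrableOn_weight_Ioc hξ t
  have hS : Ioc 0 (t : ℝ) ⊆ Ioi 0 := Ioc_subset_Ioi_self
  have hfs := h.isForwardSolution
  refine hasDerivAt_measureReal_le (f := fun x => Real.exp (-ξ * t) * ouDensity α β ν x t y +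
    ξ * ouMixture α β ν ξ (Ioc 0 (t : ℝ)) x) (hfs.measurable t) ?_ (fun x => ?_) ?_ (fun z => ?_) x
  · exact (continuous_const.mul (continuous_ouDensity hα hν ht' y)).add
      (continuous_const.mul (continuous_ouMixture hα hν hS measurableSet_Ioc hw))
  · exact add_nonneg (mul_nonneg (Real.exp_pos _).le (ouDensity_nonneg _ _ _))
      (mul_nonneg hξ (ouMixture_nonneg _ _))
  · exact ((integrable_ouDensity _ _).const_mul _).add
      ((integrable_ouMixture hα hν hS measurableSet_Ioc hw).const_mul _)
  -- Duhamel's formula; each of its two terms is the Gaussian convolution of one summand of the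
  -- density.
  · have h1 := hfs.integral_ouTest hα hν hξ z t
    simp_rw [ouTest_zero] at h1
    rw [h1]
    have h2 : ∫ ω, ouTest α β ν z t (X 0 ω) ∂P = ouTest α β ν z t y := by
      rw [integral_congr_ae (g := fun _ => ouTest α β ν z t y)
        (h.initial.mono fun ω hω => by simp only [hω])]
      simp
    obtain ⟨i1, e1⟩ := integral_heatKernel_mul_ouMixture (β := β) hα hν hS measurableSet_Ioc hw z
    have i2 : Integrable (fun x => heatKernel 1 (z - x) * ouDensity α β ν x t y) :=
      (integrable_ouDensity _ _).bdd_mul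
        (continuous_heatKernel_one_sub z).aestronglyMeasurable
        (Eventually.of_forall fun x => norm_heatKernel_one_le _)
    rw [h2, intervalIntegral.integral_of_le ht'.le, ← e1,
      ← integral_heatKernel_mul_ouDensity hα hν ht', ← integral_const_mul, ← integral_const_mul,
      ← integral_add (i2.const_mul _) (i1.const_mul _)]
    congr 1 with w
    ring

lemma tendsto_resetDensity (hα : 0 < α) (hν : 0 < ν) (hξ : 0 < ξ) (x y : ℝ) :
    Tendsto (fun t : ℝ≥0 => Real.exp (-ξ * t) * ouDensity α β ν x t y +
      ξ * ouMixture α β ν ξ (Ioc 0 (t : ℝ)) x) atTop (𝓝 (steadyDensity α β ν ξ x)) := by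
  have hc : Tendsto (fun t : ℝ≥0 => (t : ℝ)) atTop atTop := NNReal.tendsto_coe_atTop.2 tendsto_id
  have h1 : Tendsto (fun t : ℝ≥0 => Real.exp (-ξ * t) * ouDensity α β ν x t y) atTop
      (𝓝 (0 * ouSteadyDensity β ν x)) := by
    refine Tendsto.mul ?_ ((tendsto_ouDensity hα hν x y).comp hc)
    exact Real.tendsto_exp_atBot.comp (hc.const_mul_atTop_of_neg (neg_lt_zero.2 hξ))
  have h2 : Tendsto (fun t : ℝ≥0 => ouMixture α β ν ξ (Ioc 0 (t : ℝ)) x) atTop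
      (𝓝 (ouMixture α β ν ξ (Ioi 0) x)) := by
    have := intervalIntegral_tendsto_integral_Ioi 0 (integrableOn_weight_mul_ouDensity (β := β)
      hα hν le_rfl measurableSet_Ioi (integrableOn_weight_Ioi hξ) x) hc
    refine this.congr fun t => ?_
    rw [intervalIntegral.integral_of_le t.coe_nonneg]
    rfl
  have h3 := h1.add (h2.const_mul ξ)
  rwa [zero_mul, zero_add] at h3

/-- A probability density under which the killed generator has the defect `-ξ φ(0)` on the test
functions is the steady-state density. -/
theorem eq_steadyDensity (hα : 0 < α) (hν : 0 < ν) (hξ : 0 < ξ) {C : ℝ → ℝ} (hC : Continuous C)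
    (hC0 : ∀ x, 0 ≤ C x) (hCi : Integrable C)
    (h : ∀ φ, IsTestFunction φ →
      (∫ x, resetGenerator α β ν 0 φ x * C x) - ξ * ∫ x, φ x * C x = -ξ * φ 0) :
    C = steadyDensity α β ν ξ := by
  have hC1 : ∫ x, C x = 1 := by
    have h1 := h _ (isTestFunction_const 1)
    have h2 : ∀ x, resetGenerator α β ν 0 (fun _ => 1) x = 0 := fun x => by simp [resetGenerator]
    simp only [h2, zero_mul, integral_zero, one_mul] at h1
    exact mul_left_cancel₀ hξ.ne' (by linarith)
  set κ : Measure ℝ := volume.withDensity fun x => ENNReal.ofReal (C x) with hκ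
  have hfin : IsFiniteMeasure κ := isFiniteMeasure_withDensity_of_integrable hCi
  have hint : ∀ g : ℝ → ℝ, ∫ x, g x ∂κ = ∫ x, g x * C x :=
    integral_withDensity_ofReal hC hC0
  have hprob : IsProbabilityMeasure κ := by
    constructor
    have h1 := hint fun _ => 1
    simp only [integral_const, smul_eq_mul, mul_one, one_mul, hC1, measureReal_def] at h1
    rwa [ENNReal.toReal_eq_one_iff] at h1
  -- The process that is constant in time on the space (ℝ, κ). It is no diffusion, but the forward
  -- equation sees only one-dimensional laws, and for a stationary law it reduces to ∫ Lφ dκ = 0.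
  -- Duhamel's formula therefore applies to κ, and its initial term dies out as t → ∞.
  have hsol : IsForwardSolution α β ν ξ κ fun _ x => x := by
    refine ⟨fun _ => measurable_id, fun _ _ => continuousWithinAt_const, fun φ hφ t => ?_,
      fun φ hφ t => ?_⟩
    · simp only [intervalIntegral.integral_const]
      exact ((hφ.continuous_resetGenerator ξ).const_smul ((t : ℝ) - 0)).aestronglyMeasurable
    · simp only [intervalIntegral.integral_const, smul_eq_mul]
      rw [integral_const_mul]
      have e : ∫ x, resetGenerator α β ν ξ φ x ∂κ = 0 := by
        have h2 := h φ hφ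
        obtain ⟨A, hA⟩ := hφ.bound
        obtain ⟨B, hB⟩ := hφ.exists_bound_resetGenerator α β ν 0
        have i1 : Integrable (resetGenerator α β ν 0 φ) κ := Integrable.of_bound
          (hφ.continuous_resetGenerator 0).aestronglyMeasurable B (Eventually.of_forall hB)
        have i2 : Integrable φ κ := Integrable.of_bound
          hφ.smooth.continuous.aestronglyMeasurable A (Eventually.of_forall fun x => (hA x).1)
        have e2 : ∀ x, resetGenerator α β ν ξ φ x =
            resetGenerator α β ν 0 φ x - ξ * φ x + ξ * φ 0 := fun x => by
          simp only [resetGenerator]; ring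
        simp_rw [e2]
        have i3 : Integrable (fun x => resetGenerator α β ν 0 φ x - ξ * φ x) κ :=
          i1.sub (i2.const_mul ξ)
        rw [integral_add i3 (integrable_const _),
          integral_sub i1 (i2.const_mul ξ), integral_const_mul, hint, hint, h2]
        simp
      rw [e, mul_zero, add_zero]
  have hWeq : κ = volume.withDensity fun x => ENNReal.ofReal (steadyDensity α β ν ξ x) := by
    have := isFiniteMeasure_withDensity_of_integrable (integrable_steadyDensity (β := β) hα hν hξ)
    refine measure_eq_of_integral_heatKernel_eq fun z => ?_
    rw [integral_withDensity_ofReal (continuous_steadyDensity hα hν hξ) (steadyDensity_nonneg hξ)]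
    obtain ⟨K, hK⟩ := exists_bound_ouTest hα hν β z
    have hc : Tendsto (fun t : ℝ≥0 => (t : ℝ)) atTop atTop := NNReal.tendsto_coe_atTop.2 tendsto_id
    obtain ⟨i1, e1⟩ := integral_heatKernel_mul_ouMixture (β := β) hα hν le_rfl measurableSet_Ioi
      (integrableOn_weight_Ioi hξ) z
    have hexp : Tendsto (fun t : ℝ≥0 => Real.exp (-ξ * t)) atTop (𝓝 0) :=
      Real.tendsto_exp_atBot.comp (hc.const_mul_atTop_of_neg (neg_lt_zero.2 hξ))
    have l1 : Tendsto (fun t : ℝ≥0 => Real.exp (-ξ * t) * ∫ x, ouTest α β ν z t x ∂κ) atTop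
        (𝓝 0) := by
      refine hexp.zero_mul_isBoundedUnder_le ⟨K, eventually_map.2 (Eventually.of_forall fun t => ?_)⟩
      have := norm_integral_le_of_norm_le_const (μ := κ) (f := ouTest α β ν z t) (C := K)
        (Eventually.of_forall fun x => (hK t t.2 x).1)
      simpa using this
    have iI : IntegrableOn (fun r => Real.exp (-ξ * r) * ouTest α β ν z r 0) (Ioi 0) := by
      have i2 : IntegrableOn (fun r : ℝ => Real.exp (-ξ * r)) (Ioi 0) := by
        simpa using integrableOn_exp_mul_Ioi (neg_lt_zero.2 hξ) 0
      refine Integrable.mul_bdd (c := K) i2 ?_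
        ((ae_restrict_mem measurableSet_Ioi).mono fun r hr => (hK r (le_of_lt hr) 0).1)
      refine ContinuousOn.aestronglyMeasurable ?_ measurableSet_Ioi
      exact (continuousOn_ouTest (β := β) (z := z) hα hν).comp (f := fun r : ℝ => (r, (0 : ℝ)))
        (by fun_prop) fun r hr => ⟨show 0 ≤ r from le_of_lt hr, mem_univ _⟩
    have l2 := intervalIntegral_tendsto_integral_Ioi 0 iI hc
    have l3 := l1.add (l2.const_mul ξ)
    have l4 : Tendsto (fun _ : ℝ≥0 => ∫ x, heatKernel 1 (z - x) ∂κ) atTop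
        (𝓝 (0 + ξ * ∫ r in Ioi 0, Real.exp (-ξ * r) * ouTest α β ν z r 0)) := by
      refine l3.congr fun t => ?_
      rw [← hsol.integral_ouTest hα hν hξ.le z t]
      simp_rw [ouTest_zero]
    rw [tendsto_nhds_unique tendsto_const_nhds l4, zero_add, ← e1, ← integral_const_mul]
    congr 1 with w
    rw [steadyDensity_eq_ouMixture]
    ring
  -- Equality of measures gives equality of densities almost everywhere; continuity makes it hold
  -- everywhere.
  rw [hκ, withDensity_eq_iff_of_sigmaFinite (by fun_prop)
    (by have := continuous_steadyDensity (β := β) hα hν hξ; fun_prop)] at hWeq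
  refine hC.ae_eq_iff_eq volume (continuous_steadyDensity hα hν hξ) |>.1 (hWeq.mono fun x hx => ?_)
  exact (ENNReal.ofReal_eq_ofReal_iff (hC0 x) (steadyDensity_nonneg hξ x)).1 hx

end

/-! ### The integral representation of the parabolic cylinder function -/

/-- The solution of Hermite's equation that, up to the factor `exp (-z ^ 2 / 4) / Γ a`, is the
parabolic cylinder function of order `-a`. -/
noncomputable def hermiteIntegral (a z : ℝ) : ℝ :=
  ∫ t in Ioi (0 : ℝ), t ^ (a - 1) * Real.exp (-z * t - t ^ 2 / 2)

section
variable {a : ℝ}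

lemma integrableOn_hermiteIntegral (ha : 0 < a) (z : ℝ) :
    IntegrableOn (fun t : ℝ => t ^ (a - 1) * Real.exp (-z * t - t ^ 2 / 2)) (Ioi 0) := by
  have h := (integrableOn_rpow_mul_exp_neg_mul_sq (b := 1 / 4) (by norm_num)
    (s := a - 1) (by linarith)).mul_const (Real.exp (z ^ 2))
  refine Integrable.mono' h ((by fun_prop : Measurable fun t : ℝ =>
    t ^ (a - 1) * Real.exp (-z * t - t ^ 2 / 2)).aestronglyMeasurable) ?_
  refine (ae_restrict_mem measurableSet_Ioi).mono fun t ht => ?_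
  have h0 : 0 ≤ t ^ (a - 1) := Real.rpow_nonneg (le_of_lt ht) _
  rw [Real.norm_eq_abs, abs_of_nonneg (by positivity), mul_assoc, ← Real.exp_add]
  gcongr
  -- -zt - t²/2 ≤ z² - t²/4, since the difference of the two sides is (z + t/2)².
  nlinarith [sq_nonneg (z + t / 2)]

lemma hermiteIntegral_nonneg (a z : ℝ) : 0 ≤ hermiteIntegral a z :=
  setIntegral_nonneg measurableSet_Ioi fun _ ht =>
    mul_nonneg (Real.rpow_nonneg (le_of_lt ht) _) (Real.exp_pos _).le

lemma antitone_hermiteIntegral (ha : 0 < a) : Antitone (hermiteIntegral a) := by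
  intro z w hzw
  refine setIntegral_mono_on (integrableOn_hermiteIntegral ha w)
    (integrableOn_hermiteIntegral ha z) measurableSet_Ioi fun t ht => ?_
  have ht : 0 < t := ht
  have h0 : 0 ≤ t ^ (a - 1) := Real.rpow_nonneg ht.le _
  gcongr

lemma hasDerivAt_hermiteIntegral (ha : 0 < a) (z : ℝ) :
    HasDerivAt (hermiteIntegral a) (-hermiteIntegral (a + 1) z) z := by
  have hm : ∀ b w : ℝ, AEStronglyMeasurable
      (fun t : ℝ => t ^ (b - 1) * Real.exp (-w * t - t ^ 2 / 2)) (volume.restrict (Ioi 0)) :=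
    fun b w => (by fun_prop : Measurable fun t : ℝ =>
      t ^ (b - 1) * Real.exp (-w * t - t ^ 2 / 2)).aestronglyMeasurable
  have h := (hasDerivAt_integral_of_dominated_loc_of_deriv_le (μ := volume.restrict (Ioi 0))
    (F := fun w t : ℝ => t ^ (a - 1) * Real.exp (-w * t - t ^ 2 / 2))
    (F' := fun w t : ℝ => -(t ^ (a + 1 - 1) * Real.exp (-w * t - t ^ 2 / 2)))
    (bound := fun t : ℝ => t ^ (a + 1 - 1) * Real.exp (-(z - 1) * t - t ^ 2 / 2))
    (s := Ioi (z - 1)) (x₀ := z) (Ioi_mem_nhds (by linarith))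
    (Eventually.of_forall fun w => hm a w) (integrableOn_hermiteIntegral ha z)
    (hm (a + 1) z).neg ?_ (integrableOn_hermiteIntegral (by linarith) _) ?_).2
  · rwa [integral_neg] at h
  · refine (ae_restrict_mem measurableSet_Ioi).mono fun t ht w hw => ?_
    have ht : 0 < t := ht
    have hw : z - 1 < w := hw
    have h0 : 0 ≤ t ^ (a + 1 - 1) := Real.rpow_nonneg ht.le _
    rw [norm_neg, Real.norm_eq_abs, abs_of_nonneg (by positivity)]
    gcongr
  · refine (ae_restrict_mem measurableSet_Ioi).mono fun t ht w _ => ?_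
    have ht : 0 < t := ht
    have h1 : HasDerivAt (fun w : ℝ => -w * t - t ^ 2 / 2) (-t) w := by
      simpa using ((hasDerivAt_id w).neg.mul_const t).sub_const (t ^ 2 / 2)
    refine (h1.exp.const_mul (t ^ (a - 1))).congr_deriv ?_
    rw [show a + 1 - 1 = (a - 1) + 1 by ring, Real.rpow_add ht, Real.rpow_one]
    ring

lemma continuous_hermiteIntegral (ha : 0 < a) : Continuous (hermiteIntegral a) :=
  continuous_iff_continuousAt.2 fun z => (hasDerivAt_hermiteIntegral ha z).continuousAt

/-- Integrate the derivative of t^a e^{-zt-t²/2} over the half-line; the boundary term at 0 vanishes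
because a > 0. Since H_a' = -H_{a+1}, this is Hermite's equation H'' - zH' = aH. -/
lemma hermiteIntegral_add_two (ha : 0 < a) (z : ℝ) :
    hermiteIntegral (a + 2) z + z * hermiteIntegral (a + 1) z = a * hermiteIntegral a z := by
  have hi0 := integrableOn_hermiteIntegral ha z
  have hi1 := integrableOn_hermiteIntegral (a := a + 1) (by linarith) z
  have hi2 := integrableOn_hermiteIntegral (a := a + 2) (by linarith) z
  have hd : ∀ t ∈ Ioi (0 : ℝ), HasDerivAt
      (fun t : ℝ => t ^ (a + 1 - 1) * Real.exp (-z * t - t ^ 2 / 2))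
      (a * (t ^ (a - 1) * Real.exp (-z * t - t ^ 2 / 2))
        - z * (t ^ (a + 1 - 1) * Real.exp (-z * t - t ^ 2 / 2))
        - t ^ (a + 2 - 1) * Real.exp (-z * t - t ^ 2 / 2)) t := by
    intro t ht
    have ht : 0 < t := ht
    have h1 : HasDerivAt (fun t : ℝ => -z * t - t ^ 2 / 2) (-z - t) t := by
      have := ((hasDerivAt_id t).const_mul (-z)).sub (((hasDerivAt_id t).pow 2).div_const 2)
      refine this.congr_deriv ?_
      simp
    have h2 := Real.hasDerivAt_rpow_const (p := a + 1 - 1) (Or.inl ht.ne')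
    refine (h2.mul h1.exp).congr_deriv ?_
    rw [show a + 2 - 1 = (a + 1 - 1) + 1 by ring, Real.rpow_add ht, Real.rpow_one]
    rw [show a + 1 - 1 - 1 = a - 1 by ring]
    ring
  have hfi := ((hi0.const_mul a).sub (hi1.const_mul z)).sub hi2
  have hlim := tendsto_zero_of_hasDerivAt_of_integrableOn_Ioi hd hfi hi1
  have hc : ContinuousWithinAt (fun t : ℝ => t ^ (a + 1 - 1) * Real.exp (-z * t - t ^ 2 / 2))
      (Ici 0) 0 := by
    refine ContinuousAt.continuousWithinAt (ContinuousAt.mul ?_ (by fun_prop))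
    exact Real.continuousAt_rpow_const _ _ (Or.inr (by linarith))
  have h := integral_Ioi_of_hasDerivAt_of_tendsto hc hd hfi hlim
  rw [Real.zero_rpow (by linarith), zero_mul, sub_zero] at h
  have hi01 : Integrable (fun t : ℝ => a * (t ^ (a - 1) * Real.exp (-z * t - t ^ 2 / 2))
        - z * (t ^ (a + 1 - 1) * Real.exp (-z * t - t ^ 2 / 2))) (volume.restrict (Ioi 0)) :=
    (hi0.const_mul a).sub (hi1.const_mul z)
  rw [integral_sub hi01 hi2, integral_sub (hi0.const_mul a) (hi1.const_mul z),
    integral_const_mul, integral_const_mul] at h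
  simp only [hermiteIntegral]
  linarith

lemma hermiteIntegral_zero (ha : 0 < a) :
    hermiteIntegral a 0 = 2 ^ (a / 2) / 2 * Real.Gamma (a / 2) := by
  have h := integral_rpow_mul_exp_neg_mul_rpow (p := 2) (q := a - 1) (b := 1 / 2)
    (by norm_num) (by linarith) (by norm_num)
  have h1 : hermiteIntegral a 0 =
      ∫ t in Ioi (0 : ℝ), t ^ (a - 1) * Real.exp (-(1 / 2) * t ^ (2 : ℝ)) := by
    refine setIntegral_congr_fun measurableSet_Ioi fun t _ => ?_
    rw [Real.rpow_two]
    congr 2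
    ring
  rw [h1, h, sub_add_cancel, one_div, Real.inv_rpow zero_le_two, ← Real.rpow_neg zero_le_two]
  rw [neg_div, neg_neg]
  ring

/-- Legendre's duplication formula; the left side is the Wronskian at z = 0. -/
lemma hermiteIntegral_zero_mul (ha : 0 < a) :
    2 * (hermiteIntegral a 0 * hermiteIntegral (a + 1) 0) =
      Real.sqrt (2 * Real.pi) * Real.Gamma a := by
  rw [hermiteIntegral_zero ha, hermiteIntegral_zero (by linarith : 0 < a + 1)]
  have h := Real.Gamma_mul_Gamma_add_half (a / 2)
  rw [show a / 2 + 1 / 2 = (a + 1) / 2 by ring, show 2 * (a / 2) = a by ring] at h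
  calc _ = (2 : ℝ) ^ (a / 2) * 2 ^ ((a + 1) / 2) / 2 *
        (Real.Gamma (a / 2) * Real.Gamma ((a + 1) / 2)) := by ring
    _ = (2 : ℝ) ^ (a / 2) * 2 ^ ((a + 1) / 2) * 2 ^ (1 - a) / 2 *
        (Real.Gamma a * Real.sqrt Real.pi) := by rw [h]; ring
    _ = _ := by
      rw [← Real.rpow_add zero_lt_two, ← Real.rpow_add zero_lt_two,
        show a / 2 + (a + 1) / 2 + (1 - a) = 1 / 2 + 1 by ring, Real.rpow_add zero_lt_two,
        Real.rpow_one, ← Real.sqrt_eq_rpow, Real.sqrt_mul zero_le_two]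
      ring

/-- The Wronskian of the solutions `hermiteIntegral a z` and `hermiteIntegral a (-z)`. -/
lemma hermiteIntegral_wronskian (ha : 0 < a) (z : ℝ) :
    hermiteIntegral (a + 1) z * hermiteIntegral a (-z) +
      hermiteIntegral a z * hermiteIntegral (a + 1) (-z) =
      Real.sqrt (2 * Real.pi) * Real.Gamma a * Real.exp (z ^ 2 / 2) := by
  -- Abel's identity: the Wronskian times e^{-z²/2} is constant, hence equal to its value at 0.
  set w : ℝ → ℝ := fun z => (hermiteIntegral (a + 1) z * hermiteIntegral a (-z) +
      hermiteIntegral a z * hermiteIntegral (a + 1) (-z)) * Real.exp (-z ^ 2 / 2) with hw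
  have hneg : ∀ b, 0 < b → ∀ z, HasDerivAt (fun z => hermiteIntegral b (-z))
      (hermiteIntegral (b + 1) (-z)) z := by
    intro b hb z
    exact ((hasDerivAt_hermiteIntegral hb (-z)).comp z (hasDerivAt_neg z)).congr_deriv (by ring)
  have hd : ∀ z, HasDerivAt w 0 z := by
    intro z
    have ha1 : 0 < a + 1 := by linarith
    have h1 : HasDerivAt (fun z : ℝ => Real.exp (-z ^ 2 / 2)) (Real.exp (-z ^ 2 / 2) * -z) z := by
      have : HasDerivAt (fun z : ℝ => -z ^ 2 / 2) (-z) z := by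
        refine (((hasDerivAt_id z).fun_pow 2).fun_neg.div_const 2).congr_deriv ?_
        simp
        ring
      exact this.exp
    refine ((((hasDerivAt_hermiteIntegral ha1 z).mul (hneg a ha z)).add
      ((hasDerivAt_hermiteIntegral ha z).mul (hneg _ ha1 z))).mul h1).congr_deriv ?_
    have e1 := hermiteIntegral_add_two ha z
    have e2 := hermiteIntegral_add_two ha (-z)
    rw [show a + 1 + 1 = a + 2 by ring]
    simp only [Pi.add_apply, Pi.mul_apply]
    have e1' : hermiteIntegral (a + 2) z =
        a * hermiteIntegral a z - z * hermiteIntegral (a + 1) z := by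
      linarith
    have e2' : hermiteIntegral (a + 2) (-z) =
        a * hermiteIntegral a (-z) + z * hermiteIntegral (a + 1) (-z) := by
      linarith
    rw [e1', e2']
    ring
  have hconst := is_const_of_deriv_eq_zero (fun z => (hd z).differentiableAt)
    (fun z => (hd z).deriv) z 0
  simp only [hw, neg_zero] at hconst
  have h0 := hermiteIntegral_zero_mul ha
  have he : Real.exp (-z ^ 2 / 2) * Real.exp (z ^ 2 / 2) = 1 := by
    rw [← Real.exp_add, neg_div, neg_add_cancel, Real.exp_zero]
  calc _ = (hermiteIntegral (a + 1) z * hermiteIntegral a (-z) +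
      hermiteIntegral a z * hermiteIntegral (a + 1) (-z)) * Real.exp (-z ^ 2 / 2) *
        Real.exp (z ^ 2 / 2) := by rw [mul_assoc _ (Real.exp _), he, mul_one]
    _ = _ := by
      rw [hconst, ← h0]
      simp
      ring

/-! ### Power series -/

lemma hasSum_exp_real (x : ℝ) : HasSum (fun n : ℕ => x ^ n / n.factorial) (Real.exp x) := by
  rw [Real.exp_eq_exp_ℝ]
  exact NormedSpace.expSeries_div_hasSum_exp x

/-- Expansion of e^{-zt} under the integral sign; the absolute values of the terms sum to the
integrand at -|z|, which is integrable. -/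
lemma hasSum_hermiteIntegral (ha : 0 < a) (z : ℝ) :
    HasSum (fun n : ℕ => (-z) ^ n / n.factorial * hermiteIntegral (a + n) 0)
      (hermiteIntegral a z) := by
  have hterm : ∀ n : ℕ, (-z) ^ n / n.factorial * hermiteIntegral (a + n) 0 =
      ∫ t in Ioi (0 : ℝ), (-z * t) ^ n / n.factorial * (t ^ (a - 1) * Real.exp (-t ^ 2 / 2)) := by
    intro n
    rw [hermiteIntegral, ← integral_const_mul]
    refine setIntegral_congr_fun measurableSet_Ioi fun t ht => ?_
    have ht : 0 < t := ht
    rw [show a + n - 1 = (a - 1) + n by ring, Real.rpow_add ht, Real.rpow_natCast, mul_pow,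
      neg_zero, zero_mul, zero_sub, neg_div]
    ring
  simp_rw [hterm]
  refine hasSum_integral_of_dominated_convergence
    (fun n t => (|z| * t) ^ n / n.factorial * (t ^ (a - 1) * Real.exp (-t ^ 2 / 2)))
    (fun n => ?_) (fun n => ?_) ?_ ?_ ?_
  · exact (by fun_prop : Measurable fun t : ℝ => (-z * t) ^ n / n.factorial *
      (t ^ (a - 1) * Real.exp (-t ^ 2 / 2))).aestronglyMeasurable
  · refine (ae_restrict_mem measurableSet_Ioi).mono fun t ht => ?_
    have ht : 0 < t := ht
    have h0 : 0 ≤ t ^ (a - 1) := Real.rpow_nonneg ht.le _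
    rw [norm_mul, norm_div, norm_pow, norm_mul, norm_neg, Real.norm_eq_abs, Real.norm_eq_abs,
      abs_of_pos ht, Real.norm_eq_abs, Nat.abs_cast, Real.norm_eq_abs,
      abs_of_nonneg (by positivity : 0 ≤ t ^ (a - 1) * Real.exp (-t ^ 2 / 2))]
  · exact Eventually.of_forall fun t =>
      (Real.summable_pow_div_factorial (|z| * t)).mul_right _
  · refine (integrableOn_hermiteIntegral ha (-|z|)).congr (Eventually.of_forall fun t => ?_)
    beta_reduce
    rw [tsum_mul_right, (hasSum_exp_real _).tsum_eq, mul_left_comm, ← Real.exp_add]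
    congr 2
    ring
  · refine Eventually.of_forall fun t => ?_
    have h := (hasSum_exp_real (-z * t)).mul_right (t ^ (a - 1) * Real.exp (-t ^ 2 / 2))
    rw [mul_left_comm, ← Real.exp_add, neg_div, ← sub_eq_add_neg] at h
    simpa only [neg_div] using h

lemma hermiteIntegral_zero_add_two_mul (ha : 0 < a) (n : ℕ) :
    hermiteIntegral (a + 2 * n) 0 =
      2 ^ n * (ascPochhammer ℝ n).eval (a / 2) * hermiteIntegral a 0 := by
  induction n with
  | zero => simp
  | succ n ih =>
    have h := hermiteIntegral_add_two (a := a + 2 * n) (by positivity) 0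
    rw [zero_mul, add_zero] at h
    rw [show a + 2 * ((n + 1 : ℕ) : ℝ) = a + 2 * n + 2 by push_cast; ring, h, ih,
      ascPochhammer_succ_eval]
    ring

lemma factorial_two_mul_eq (n : ℕ) : ((2 * n).factorial : ℝ) =
    4 ^ n * n.factorial * (ascPochhammer ℝ n).eval (1 / 2) := by
  induction n with
  | zero => simp
  | succ n ih =>
    rw [show 2 * (n + 1) = 2 * n + 1 + 1 by ring, Nat.factorial_succ, Nat.factorial_succ,
      Nat.factorial_succ, ascPochhammer_succ_eval]
    push_cast
    rw [ih]
    ring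

lemma factorial_two_mul_add_one_eq (n : ℕ) : ((2 * n + 1).factorial : ℝ) =
    4 ^ n * n.factorial * (ascPochhammer ℝ n).eval (3 / 2) := by
  induction n with
  | zero => simp
  | succ n ih =>
    rw [show 2 * (n + 1) + 1 = 2 * n + 1 + 1 + 1 by ring, Nat.factorial_succ, Nat.factorial_succ,
      Nat.factorial_succ n, ascPochhammer_succ_eval]
    push_cast
    rw [ih]
    ring

lemma hermiteIntegral_even_term (ha : 0 < a) (z : ℝ) (n : ℕ) :
    (-z) ^ (2 * n) / (2 * n).factorial * hermiteIntegral (a + (2 * n : ℕ)) 0 =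
      hermiteIntegral a 0 * ((ascPochhammer ℝ n).eval (a / 2) / (ascPochhammer ℝ n).eval (1 / 2) *
        ((z ^ 2 / 2) ^ n / n.factorial)) := by
  have h4 : (4 : ℝ) ^ n = 2 ^ n * 2 ^ n := by rw [← mul_pow]; norm_num
  have hp : 0 < (ascPochhammer ℝ n).eval (1 / 2 : ℝ) := ascPochhammer_pos n _ (by norm_num)
  rw [Nat.cast_mul, Nat.cast_ofNat, hermiteIntegral_zero_add_two_mul ha, factorial_two_mul_eq,
    pow_mul, neg_sq, div_pow, h4]
  generalize (ascPochhammer ℝ n).eval (1 / 2 : ℝ) = p at *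
  field_simp

lemma hermiteIntegral_odd_term (ha : 0 < a) (z : ℝ) (n : ℕ) :
    (-z) ^ (2 * n + 1) / (2 * n + 1).factorial * hermiteIntegral (a + (2 * n + 1 : ℕ)) 0 =
      -(z * hermiteIntegral (a + 1) 0) *
      ((ascPochhammer ℝ n).eval ((a + 1) / 2) / (ascPochhammer ℝ n).eval (3 / 2) *
        ((z ^ 2 / 2) ^ n / n.factorial)) := by
  have h4 : (4 : ℝ) ^ n = 2 ^ n * 2 ^ n := by rw [← mul_pow]; norm_num
  have hp : 0 < (ascPochhammer ℝ n).eval (3 / 2 : ℝ) := ascPochhammer_pos n _ (by norm_num)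
  have hn : a + ((2 * n + 1 : ℕ) : ℝ) = a + 1 + 2 * n := by push_cast; ring
  rw [hn, hermiteIntegral_zero_add_two_mul (by linarith), factorial_two_mul_add_one_eq, pow_succ,
    pow_mul, neg_sq, div_pow, h4]
  generalize (ascPochhammer ℝ n).eval (3 / 2 : ℝ) = p at *
  field_simp

/-- The power series split by parity. The recursion H_{b+2}(0) = b H_b(0) produces the rising
factorials in the numerators, and (2n)! and (2n+1)! produce those of 1/2 and 3/2 in the
denominators. -/
lemma hermiteIntegral_eq_kummer (ha : 0 < a) (z : ℝ) :
    hermiteIntegral a z = hermiteIntegral a 0 * kummer (a / 2) (1 / 2) (z ^ 2 / 2) -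
      z * hermiteIntegral (a + 1) 0 * kummer ((a + 1) / 2) (3 / 2) (z ^ 2 / 2) := by
  have h := hasSum_hermiteIntegral ha z
  set F : ℕ → ℝ := fun n => (-z) ^ n / n.factorial * hermiteIntegral (a + n) 0 with hF
  have he : Summable fun n : ℕ => F (2 * n) :=
    h.summable.comp_injective (mul_right_injective₀ (two_ne_zero' ℕ))
  have ho : Summable fun n : ℕ => F (2 * n + 1) :=
    h.summable.comp_injective (i := fun n : ℕ => 2 * n + 1) fun m n hmn => by simpa using hmn
  rw [← h.tsum_eq, ← tsum_even_add_odd he ho, tsum_congr (hermiteIntegral_even_term ha z),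
    tsum_congr (hermiteIntegral_odd_term ha z), tsum_mul_left, tsum_mul_left, kummer, kummer]
  ring

/-- Both sides are combinations of the same two Kummer functions, so only the two coefficients have
to be compared; each comparison is the duplication formula for Γ(a/2) Γ((a+1)/2). -/
theorem parabolicCylinder_neg (ha : 0 < a) (z : ℝ) :
    parabolicCylinder (-a) z = Real.exp (-z ^ 2 / 4) * hermiteIntegral a z / Real.Gamma a := by
  have hG := Real.Gamma_pos_of_pos ha
  have hG1 := Real.Gamma_pos_of_pos (half_pos ha)
  have hG2 := Real.Gamma_pos_of_pos (show 0 < (a + 1) / 2 by linarith)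
  have hdup := Real.Gamma_mul_Gamma_add_half (a / 2)
  rw [show a / 2 + 1 / 2 = (a + 1) / 2 by ring, show 2 * (a / 2) = a by ring,
    sub_eq_add_neg 1 a, Real.rpow_add zero_lt_two, Real.rpow_one] at hdup
  rw [hermiteIntegral_eq_kummer ha, hermiteIntegral_zero ha,
    hermiteIntegral_zero (by linarith : 0 < a + 1), parabolicCylinder,
    show (1 - -a) / 2 = (a + 1) / 2 by ring, neg_neg]
  set k1 := kummer (a / 2) (1 / 2) (z ^ 2 / 2)
  set k2 := kummer ((a + 1) / 2) (3 / 2) (z ^ 2 / 2)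
  have hq : (2 : ℝ) ^ (-a / 2) * 2 ^ (a / 2) = 1 := by
    rw [← Real.rpow_add zero_lt_two, neg_div, neg_add_cancel, Real.rpow_zero]
  have hq2 : (2 : ℝ) ^ (-a) = 2 ^ (-a / 2) * 2 ^ (-a / 2) := by
    rw [← Real.rpow_add zero_lt_two]; congr 1; ring
  have hq3 : (2 : ℝ) ^ ((a + 1) / 2) = 2 ^ (a / 2) * Real.sqrt 2 := by
    rw [Real.sqrt_eq_rpow, ← Real.rpow_add zero_lt_two]; congr 1; ring
  rw [hq2] at hdup
  rw [hq3, Real.sqrt_mul zero_le_two]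
  set A := Real.Gamma (a / 2)
  set B := Real.Gamma ((a + 1) / 2)
  set G := Real.Gamma a
  set q := (2 : ℝ) ^ (-a / 2)
  set r := (2 : ℝ) ^ (a / 2)
  have e1 : q * (Real.sqrt Real.pi / B) = r / 2 * A / G := by
    rw [mul_div_assoc', div_eq_div_iff hG2.ne' hG.ne']
    linear_combination (-(r / 2)) * hdup - (Real.sqrt Real.pi * G * q) * hq
  have e2 : q * (Real.sqrt Real.pi / A) = r / 2 * B / G := by
    rw [mul_div_assoc', div_eq_div_iff hG1.ne' hG.ne']
    linear_combination (-(r / 2)) * hdup - (Real.sqrt Real.pi * G * q) * hq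
  calc _ = Real.exp (-z ^ 2 / 4) * (q * (Real.sqrt Real.pi / B) * k1 -
        Real.sqrt 2 * z * (q * (Real.sqrt Real.pi / A)) * k2) := by ring
    _ = _ := by rw [e1, e2]; ring

end

/-! ### The closed form of the steady-state density -/

section
variable {α β ν ξ : ℝ}

lemma tendsto_gaussian_cocompact (hν : 0 < ν) (β : ℝ) :
    Tendsto (fun x : ℝ => Real.exp (-(x - β) ^ 2 / ν)) (cocompact ℝ) (𝓝 0) := by
  have h1 : Tendsto (fun x : ℝ => |x - β|) (cocompact ℝ) atTop :=
    (tendsto_norm_cocompact_atTop (E := ℝ)).comp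
      (Homeomorph.subRight β).isClosedEmbedding.tendsto_cocompact
  have h2 := (tendsto_pow_atTop two_ne_zero).comp h1
  refine Real.tendsto_exp_atBot.comp ?_
  refine ((h2.const_mul_atTop_of_neg (show -ν⁻¹ < 0 by simpa using hν))).congr fun x => ?_
  simp only [Function.comp_apply, sq_abs]
  ring

lemma integrable_gaussian (hν : 0 < ν) (β : ℝ) :
    Integrable (fun x : ℝ => Real.exp (-(x - β) ^ 2 / ν)) := by
  have h := (integrable_exp_neg_mul_sq (inv_pos.2 hν)).comp_sub_right β
  refine h.congr (Eventually.of_forall fun x => ?_)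
  beta_reduce
  congr 1
  ring

/-- The flux whose derivative is `exp (-(x - β) ^ 2 / ν) * h * (L φ - ξ φ)` when `L h = ξ h`. -/
noncomputable def ouFlux (α β ν : ℝ) (φ h h₁ : ℝ → ℝ) (x : ℝ) : ℝ :=
  α * ν / 2 * (Real.exp (-(x - β) ^ 2 / ν) * (deriv φ x * h x - φ x * h₁ x))

/-- Green's identity: with the weight m = exp(-(x-β)²/ν) the generator without resetting has the
self-adjoint form m L_0 f = (αν/2)(m f')'. -/
lemma hasDerivAt_ouFlux (hν : 0 < ν) {φ h h₁ : ℝ → ℝ} {h₂ x : ℝ} (hφ : IsTestFunction φ)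
    (hh : HasDerivAt h (h₁ x) x) (hh₁ : HasDerivAt h₁ h₂ x)
    (hode : -α * (x - β) * h₁ x + α * ν / 2 * h₂ = ξ * h x) :
    HasDerivAt (ouFlux α β ν φ h h₁)
      (Real.exp (-(x - β) ^ 2 / ν) * h x * (resetGenerator α β ν 0 φ x - ξ * φ x)) x := by
  have hm : HasDerivAt (fun x : ℝ => Real.exp (-(x - β) ^ 2 / ν))
      (Real.exp (-(x - β) ^ 2 / ν) * (-(2 * (x - β)) / ν)) x := by
    have : HasDerivAt (fun x : ℝ => -(x - β) ^ 2 / ν) (-(2 * (x - β)) / ν) x := by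
      refine ((((hasDerivAt_id x).sub_const β).fun_pow 2).fun_neg.div_const ν).congr_deriv ?_
      simp
    exact this.exp
  have d1 := (hφ.smooth.differentiable (by simp) x).hasDerivAt
  have d2 := (hφ.contDiff_deriv.differentiable (by simp) x).hasDerivAt
  refine ((hm.mul ((d2.mul hh).sub (d1.mul hh₁))).const_mul (α * ν / 2)).congr_deriv ?_
  simp only [resetGenerator, Pi.sub_apply, Pi.mul_apply]
  have e : ξ * φ x * h x = φ x * (-α * (x - β) * h₁ x + α * ν / 2 * h₂) := by rw [hode]; ring
  have e2 : Real.exp (-(x - β) ^ 2 / ν) * h x * (-α * (x - β) * deriv φ x +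
      1 / 2 * (α * ν) * deriv (deriv φ) x + 0 * (φ 0 - φ x) - ξ * φ x) =
      Real.exp (-(x - β) ^ 2 / ν) * (h x * (-α * (x - β) * deriv φ x +
      1 / 2 * (α * ν) * deriv (deriv φ) x) - ξ * φ x * h x) := by ring
  rw [e2, e]
  field_simp
  ring

lemma tendsto_ouFlux (hν : 0 < ν) {φ h h₁ : ℝ → ℝ} (hφ : IsTestFunction φ) {l : Filter ℝ}
    (hl : l ≤ cocompact ℝ) {M : ℝ} (hM : ∀ᶠ x in l, |h x| ≤ M ∧ |h₁ x| ≤ M) :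
    Tendsto (ouFlux α β ν φ h h₁) l (𝓝 0) := by
  obtain ⟨C, hC⟩ := hφ.bound
  have h1 : Tendsto (fun x => Real.exp (-(x - β) ^ 2 / ν) * (deriv φ x * h x - φ x * h₁ x)) l
      (𝓝 0) := by
    refine ((tendsto_gaussian_cocompact hν β).mono_left hl).zero_mul_isBoundedUnder_le
      ⟨C * M + C * M, eventually_map.2 (hM.mono fun x hx => ?_)⟩
    have hC0 : 0 ≤ C := (abs_nonneg _).trans (hC 0).1
    refine (abs_sub _ _).trans ?_
    rw [abs_mul, abs_mul]
    gcongr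
    · exact (hC x).2.1
    · exact hx.1
    · exact (hC x).1
    · exact hx.2
  have h2 := h1.const_mul (α * ν / 2)
  rwa [mul_zero] at h2

lemma integrableOn_flux_deriv (hν : 0 < ν) {φ h : ℝ → ℝ} (hφ : IsTestFunction φ)
    (hh : Continuous h) {S : Set ℝ} (hS : MeasurableSet S) {M : ℝ} (hM : ∀ x ∈ S, |h x| ≤ M) :
    IntegrableOn (fun x => Real.exp (-(x - β) ^ 2 / ν) * h x *
      (resetGenerator α β ν 0 φ x - ξ * φ x)) S := by
  obtain ⟨C, hC⟩ := hφ.bound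
  obtain ⟨B, hB⟩ := hφ.exists_bound_resetGenerator α β ν 0
  have hL := hφ.continuous_resetGenerator (α := α) (β := β) (ν := ν) 0
  have hc := hφ.smooth.continuous
  refine Integrable.mono' (((integrable_gaussian hν β).integrableOn (s := S)).mul_const
    (M * (B + |ξ| * C))) (by fun_prop) ((ae_restrict_mem hS).mono fun x hx => ?_)
  have e1 : |resetGenerator α β ν 0 φ x - ξ * φ x| ≤ B + |ξ| * C := by
    refine (abs_sub _ _).trans (add_le_add (hB x) ?_)
    rw [abs_mul]
    gcongr
    exact (hC x).1
  have hM0 : 0 ≤ M := (abs_nonneg _).trans (hM x hx)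
  rw [norm_mul, norm_mul, Real.norm_eq_abs, Real.norm_eq_abs, Real.norm_eq_abs, Real.abs_exp,
    mul_assoc]
  gcongr
  exact hM x hx

lemma hasDerivAt_hermiteIntegral_affine {a : ℝ} (ha : 0 < a) (s β x : ℝ) :
    HasDerivAt (fun x => hermiteIntegral a (s * (x - β)))
      (-s * hermiteIntegral (a + 1) (s * (x - β))) x := by
  have h1 : HasDerivAt (fun x : ℝ => s * (x - β)) s x := by
    simpa using ((hasDerivAt_id x).sub_const β).const_mul s
  refine ((hasDerivAt_hermiteIntegral ha (s * (x - β))).comp x h1).congr_deriv ?_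
  ring

/-- Solutions of `L h = ξ h` for the Ornstein-Uhlenbeck generator: for `s ^ 2 = 2 / ν`, the
function `hermiteIntegral (ξ / α) (s * (x - β))`. -/
lemma hermiteIntegral_ode (hα : 0 < α) (hν : 0 < ν) (hξ : 0 < ξ) {s : ℝ} (hs : s ^ 2 = 2 / ν)
    (x : ℝ) :
    -α * (x - β) * (-s * hermiteIntegral (ξ / α + 1) (s * (x - β))) +
      α * ν / 2 * (-s * (-s * hermiteIntegral (ξ / α + 1 + 1) (s * (x - β)))) =
      ξ * hermiteIntegral (ξ / α) (s * (x - β)) := by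
  have h := hermiteIntegral_add_two (div_pos hξ hα) (s * (x - β))
  rw [show ξ / α + 1 + 1 = ξ / α + 2 by ring]
  have h1 : α * ν / 2 * (-s * (-s * hermiteIntegral (ξ / α + 2) (s * (x - β)))) =
      α * (s ^ 2 * ν / 2) * hermiteIntegral (ξ / α + 2) (s * (x - β)) := by ring
  have h2 : s ^ 2 * ν / 2 = 1 := by rw [hs]; field_simp
  have h3 : ξ = α * (ξ / α) := by field_simp
  rw [h1, h2]
  calc _ = α * (hermiteIntegral (ξ / α + 2) (s * (x - β)) + s * (x - β) *
        hermiteIntegral (ξ / α + 1) (s * (x - β))) := by ring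
    _ = α * (ξ / α) * hermiteIntegral (ξ / α) (s * (x - β)) := by rw [h]; ring
    _ = _ := by rw [← h3]

/-- The product of the two solutions of `L h = ξ h` that decay at the two ends, glued at `0`. -/
noncomputable def gluedSolution (α β ν ξ x : ℝ) : ℝ :=
  if 0 ≤ x then hermiteIntegral (ξ / α) (Real.sqrt (2 / ν) * β) *
      hermiteIntegral (ξ / α) (Real.sqrt (2 / ν) * (x - β))
    else hermiteIntegral (ξ / α) (-Real.sqrt (2 / ν) * β) *
      hermiteIntegral (ξ / α) (-Real.sqrt (2 / ν) * (x - β))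

/-- The closed form of the steady-state density, in terms of `hermiteIntegral`. -/
noncomputable def gluedDensity (α β ν ξ x : ℝ) : ℝ :=
  ξ / α / (Real.Gamma (ξ / α) * Real.sqrt (Real.pi * ν)) *
    (Real.exp (-(x - β) ^ 2 / ν) * gluedSolution α β ν ξ x)

lemma gluedSolution_nonneg (x : ℝ) : 0 ≤ gluedSolution α β ν ξ x := by
  unfold gluedSolution
  split_ifs <;> exact mul_nonneg (hermiteIntegral_nonneg _ _) (hermiteIntegral_nonneg _ _)

/-- The constant in each branch is the value at 0 of the solution used in the other branch, so the
two branches agree at 0. -/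
lemma continuous_gluedSolution (hα : 0 < α) (hξ : 0 < ξ) :
    Continuous (gluedSolution α β ν ξ) := by
  have h := continuous_hermiteIntegral (div_pos hξ hα)
  unfold gluedSolution
  refine Continuous.if_le (by fun_prop) (by fun_prop) continuous_const continuous_id fun x hx => ?_
  rw [← hx, zero_sub, mul_neg, mul_neg, neg_mul, neg_neg, mul_comm]

lemma abs_hermiteIntegral_affine_le {a : ℝ} (ha : 0 < a) {s x : ℝ} (hsx : 0 ≤ s * x) :
    |hermiteIntegral a (s * (x - β))| ≤ hermiteIntegral a (-s * β) := by
  rw [abs_of_nonneg (hermiteIntegral_nonneg _ _)]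
  exact antitone_hermiteIntegral ha (by linarith)

lemma exists_bound_gluedSolution (hα : 0 < α) (hξ : 0 < ξ) :
    ∃ M, ∀ x, |gluedSolution α β ν ξ x| ≤ M := by
  have ha := div_pos hξ hα
  refine ⟨hermiteIntegral (ξ / α) (Real.sqrt (2 / ν) * β) *
    hermiteIntegral (ξ / α) (-Real.sqrt (2 / ν) * β), fun x => ?_⟩
  unfold gluedSolution
  split_ifs with hx
  · rw [abs_mul, abs_of_nonneg (hermiteIntegral_nonneg _ _)]
    exact mul_le_mul_of_nonneg_left (abs_hermiteIntegral_affine_le ha (by positivity))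
      (hermiteIntegral_nonneg _ _)
  · rw [abs_mul, abs_of_nonneg (hermiteIntegral_nonneg _ _),
      mul_comm (hermiteIntegral (ξ / α) (Real.sqrt (2 / ν) * β))]
    push Not at hx
    have := abs_hermiteIntegral_affine_le (β := β) ha (s := -Real.sqrt (2 / ν)) (x := x)
      (by nlinarith [Real.sqrt_nonneg (2 / ν)])
    rw [neg_neg] at this
    exact mul_le_mul_of_nonneg_left this (hermiteIntegral_nonneg _ _)

/-- For s ≥ 0 monotonicity bounds the solution and its derivative on x ≥ 0 by multiples of their
values at 0, so the Gaussian weight kills the flux at infinity and only the end 0 contributes. -/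
lemma integral_flux_Ioi (hα : 0 < α) (hν : 0 < ν) (hξ : 0 < ξ) {φ : ℝ → ℝ}
    (hφ : IsTestFunction φ) {s : ℝ} (hs : s ^ 2 = 2 / ν) (hs0 : 0 ≤ s) :
    ∫ x in Ioi 0, Real.exp (-(x - β) ^ 2 / ν) * hermiteIntegral (ξ / α) (s * (x - β)) *
      (resetGenerator α β ν 0 φ x - ξ * φ x) =
    -ouFlux α β ν φ (fun x => hermiteIntegral (ξ / α) (s * (x - β)))
      (fun x => -s * hermiteIntegral (ξ / α + 1) (s * (x - β))) 0 := by
  have ha := div_pos hξ hα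
  have ha1 : 0 < ξ / α + 1 := by linarith
  have hc := continuous_hermiteIntegral ha
  have hd : ∀ x, HasDerivAt (ouFlux α β ν φ (fun x => hermiteIntegral (ξ / α) (s * (x - β)))
      (fun x => -s * hermiteIntegral (ξ / α + 1) (s * (x - β)))) _ x := fun x =>
    hasDerivAt_ouFlux hν hφ (hasDerivAt_hermiteIntegral_affine ha s β x)
      ((hasDerivAt_hermiteIntegral_affine ha1 s β x).const_mul (-s))
      (hermiteIntegral_ode hα hν hξ hs x)
  rw [integral_Ioi_of_hasDerivAt_of_tendsto (hd 0).continuousAt.continuousWithinAt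
    (fun x _ => hd x) (integrableOn_flux_deriv hν hφ (by fun_prop) measurableSet_Ioi
      fun x hx => abs_hermiteIntegral_affine_le ha (mul_nonneg hs0 (le_of_lt hx)))
    (tendsto_ouFlux hν hφ atTop_le_cocompact (M := max (hermiteIntegral (ξ / α) (-s * β))
      (s * hermiteIntegral (ξ / α + 1) (-s * β)))
      ((eventually_ge_atTop 0).mono fun x hx => ⟨?_, ?_⟩)), zero_sub]
  · exact (abs_hermiteIntegral_affine_le ha (mul_nonneg hs0 hx)).trans (le_max_left _ _)
  · rw [abs_mul, abs_neg, abs_of_nonneg hs0]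
    exact (mul_le_mul_of_nonneg_left (abs_hermiteIntegral_affine_le ha1 (mul_nonneg hs0 hx))
      hs0).trans (le_max_right _ _)

lemma integral_flux_Iic (hα : 0 < α) (hν : 0 < ν) (hξ : 0 < ξ) {φ : ℝ → ℝ}
    (hφ : IsTestFunction φ) {s : ℝ} (hs : s ^ 2 = 2 / ν) (hs0 : s ≤ 0) :
    ∫ x in Iic 0, Real.exp (-(x - β) ^ 2 / ν) * hermiteIntegral (ξ / α) (s * (x - β)) *
      (resetGenerator α β ν 0 φ x - ξ * φ x) =
    ouFlux α β ν φ (fun x => hermiteIntegral (ξ / α) (s * (x - β)))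
      (fun x => -s * hermiteIntegral (ξ / α + 1) (s * (x - β))) 0 := by
  have ha := div_pos hξ hα
  have ha1 : 0 < ξ / α + 1 := by linarith
  have hc := continuous_hermiteIntegral ha
  have hd : ∀ x, HasDerivAt (ouFlux α β ν φ (fun x => hermiteIntegral (ξ / α) (s * (x - β)))
      (fun x => -s * hermiteIntegral (ξ / α + 1) (s * (x - β)))) _ x := fun x =>
    hasDerivAt_ouFlux hν hφ (hasDerivAt_hermiteIntegral_affine ha s β x)
      ((hasDerivAt_hermiteIntegral_affine ha1 s β x).const_mul (-s))
      (hermiteIntegral_ode hα hν hξ hs x)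
  rw [integral_Iic_of_hasDerivAt_of_tendsto (hd 0).continuousAt.continuousWithinAt
    (fun x _ => hd x) (integrableOn_flux_deriv hν hφ (by fun_prop) measurableSet_Iic
      fun x hx => abs_hermiteIntegral_affine_le ha (mul_nonneg_of_nonpos_of_nonpos hs0 hx))
    (tendsto_ouFlux hν hφ atBot_le_cocompact (M := max (hermiteIntegral (ξ / α) (-s * β))
      (-s * hermiteIntegral (ξ / α + 1) (-s * β)))
      ((eventually_le_atBot 0).mono fun x hx => ⟨?_, ?_⟩)), sub_zero]
  · exact (abs_hermiteIntegral_affine_le ha (mul_nonneg_of_nonpos_of_nonpos hs0 hx)).trans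
      (le_max_left _ _)
  · rw [abs_mul, abs_neg, abs_of_nonpos hs0]
    exact (mul_le_mul_of_nonneg_left (abs_hermiteIntegral_affine_le ha1
      (mul_nonneg_of_nonpos_of_nonpos hs0 hx)) (neg_nonneg.2 hs0)).trans (le_max_right _ _)

/-- Of the two fluxes at 0, the terms with φ'(0) cancel because the glued function is continuous,
and the terms with φ(0) add up to the jump of its derivative, which is the Wronskian. -/
lemma integral_gluedSolution (hα : 0 < α) (hν : 0 < ν) (hξ : 0 < ξ) {φ : ℝ → ℝ}
    (hφ : IsTestFunction φ) :
    ∫ x, Real.exp (-(x - β) ^ 2 / ν) * gluedSolution α β ν ξ x *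
      (resetGenerator α β ν 0 φ x - ξ * φ x) =
      -(α * Real.Gamma (ξ / α) * Real.sqrt (Real.pi * ν)) * φ 0 := by
  have ha := div_pos hξ hα
  obtain ⟨M, hM⟩ := exists_bound_gluedSolution (β := β) (ν := ν) hα hξ
  have hi := fun S hS => integrableOn_flux_deriv (α := α) (β := β) (ξ := ξ) (S := S) hν hφ
    (continuous_gluedSolution (β := β) (ν := ν) hα hξ) hS (fun x _ => hM x)
  rw [← intervalIntegral.integral_Iic_add_Ioi (b := 0) (hi _ measurableSet_Iic)
    (hi _ measurableSet_Ioi)]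
  obtain ⟨s, hs⟩ : ∃ s, s = Real.sqrt (2 / ν) := ⟨_, rfl⟩
  have hs0 : 0 ≤ s := hs ▸ Real.sqrt_nonneg _
  have hs2 : s ^ 2 = 2 / ν := by rw [hs, Real.sq_sqrt (by positivity)]
  have e1 : ∫ x in Ioi 0, Real.exp (-(x - β) ^ 2 / ν) * gluedSolution α β ν ξ x *
      (resetGenerator α β ν 0 φ x - ξ * φ x) = hermiteIntegral (ξ / α) (s * β) *
      ∫ x in Ioi 0, Real.exp (-(x - β) ^ 2 / ν) * hermiteIntegral (ξ / α) (s * (x - β)) *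
      (resetGenerator α β ν 0 φ x - ξ * φ x) := by
    rw [← integral_const_mul]
    refine setIntegral_congr_fun measurableSet_Ioi fun x hx => ?_
    have hx : 0 < x := hx
    simp only [gluedSolution, if_pos hx.le, hs]
    ring
  have e2 : ∫ x in Iic 0, Real.exp (-(x - β) ^ 2 / ν) * gluedSolution α β ν ξ x *
      (resetGenerator α β ν 0 φ x - ξ * φ x) = hermiteIntegral (ξ / α) (-s * β) *
      ∫ x in Iic 0, Real.exp (-(x - β) ^ 2 / ν) * hermiteIntegral (ξ / α) (-s * (x - β)) *
      (resetGenerator α β ν 0 φ x - ξ * φ x) := by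
    -- The point 0 belongs to the other branch of the definition and is dropped as a null set.
    rw [← integral_const_mul, integral_Iic_eq_integral_Iio, integral_Iic_eq_integral_Iio]
    refine setIntegral_congr_fun measurableSet_Iio fun x hx => ?_
    have hx : x < 0 := hx
    simp only [gluedSolution, if_neg (not_le.2 hx), hs]
    ring
  rw [e1, e2, integral_flux_Ioi hα hν hξ hφ hs2 hs0,
    integral_flux_Iic hα hν hξ hφ (by rw [neg_sq, hs2]) (neg_nonpos.2 hs0)]
  have hw := hermiteIntegral_wronskian ha (s * β)
  -- The weight at 0 cancels the exponential in the Wronskian, which removes β from the constant.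
  have hexp : Real.exp (-(0 - β) ^ 2 / ν) * Real.exp ((s * β) ^ 2 / 2) = 1 := by
    rw [← Real.exp_add, mul_pow, hs2, Real.exp_eq_one_iff]
    field_simp
    ring
  have hsq : ν / 2 * s * Real.sqrt (2 * Real.pi) = Real.sqrt (Real.pi * ν) := by
    rw [hs]
    refine (Real.sqrt_eq_iff_eq_sq (by positivity) (by positivity)).2 ?_ |>.symm
    rw [mul_pow, mul_pow, Real.sq_sqrt (by positivity), Real.sq_sqrt (by positivity)]
    field_simp
  simp only [ouFlux]
  rw [show s * (0 - β) = -(s * β) by ring, show -s * (0 - β) = s * β by ring,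
    show -s * β = -(s * β) by ring]
  calc _ = -(α * (ν / 2 * s) * φ 0 * Real.exp (-(0 - β) ^ 2 / ν) *
        (hermiteIntegral (ξ / α + 1) (s * β) * hermiteIntegral (ξ / α) (-(s * β)) +
      hermiteIntegral (ξ / α) (s * β) * hermiteIntegral (ξ / α + 1) (-(s * β)))) := by ring
    _ = -(α * (ν / 2 * s * Real.sqrt (2 * Real.pi)) * Real.Gamma (ξ / α) * φ 0 *
        (Real.exp (-(0 - β) ^ 2 / ν) * Real.exp ((s * β) ^ 2 / 2))) := by rw [hw]; ring
    _ = _ := by rw [hexp, hsq]; ring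

/-- The prefactor is chosen so that the weak defect equals exactly -ξ φ(0); by the weak
characterisation the total mass need not be computed. -/
theorem gluedDensity_eq_steadyDensity (hα : 0 < α) (hν : 0 < ν) (hξ : 0 < ξ) :
    gluedDensity α β ν ξ = steadyDensity α β ν ξ := by
  have ha := div_pos hξ hα
  have hG := Real.Gamma_pos_of_pos ha
  have hc := continuous_gluedSolution (β := β) (ν := ν) hα hξ
  obtain ⟨M, hM⟩ := exists_bound_gluedSolution (β := β) (ν := ν) hα hξ
  have hcont : Continuous (gluedDensity α β ν ξ) := by
    unfold gluedDensity
    fun_prop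
  have hint : Integrable (gluedDensity α β ν ξ) :=
    ((integrable_gaussian hν β).mul_bdd hc.aestronglyMeasurable
      (Eventually.of_forall hM)).const_mul _
  refine eq_steadyDensity hα hν hξ hcont
    (fun x => mul_nonneg (by positivity)
      (mul_nonneg (Real.exp_pos _).le (gluedSolution_nonneg x)))
    hint fun φ hφ => ?_
  obtain ⟨A, hA⟩ := hφ.bound
  obtain ⟨B, hB⟩ := hφ.exists_bound_resetGenerator α β ν 0
  have i1 : Integrable fun x => resetGenerator α β ν 0 φ x * gluedDensity α β ν ξ x :=
    hint.bdd_mul (hφ.continuous_resetGenerator 0).aestronglyMeasurable (Eventually.of_forall hB)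
  have i2 : Integrable fun x => φ x * gluedDensity α β ν ξ x :=
    hint.bdd_mul hφ.smooth.continuous.aestronglyMeasurable
      (Eventually.of_forall fun x => (hA x).1)
  rw [← integral_const_mul, ← integral_sub i1 (i2.const_mul ξ)]
  have h := congrArg (fun v => ξ / α / (Real.Gamma (ξ / α) * Real.sqrt (Real.pi * ν)) * v)
    (integral_gluedSolution (β := β) hα hν hξ hφ)
  beta_reduce at h
  rw [← integral_const_mul] at h
  calc _ = _ := by
        congr 1 with x
        rw [gluedDensity]
        ring
    _ = _ := h
    _ = _ := by field_simp

/-- The parabolic cylinder form of the steady-state density. -/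
lemma steadyClosedForm_eq (hα : 0 < α) (hν : 0 < ν) (hξ : 0 < ξ) {σ : ℝ} (hσ : σ ^ 2 = 1)
    (x : ℝ) : steadyClosedForm α β ν ξ σ x =
      ξ / α / (Real.Gamma (ξ / α) * Real.sqrt (Real.pi * ν)) * (Real.exp (-(x - β) ^ 2 / ν) *
        (hermiteIntegral (ξ / α) (σ * Real.sqrt (2 / ν) * β) *
          hermiteIntegral (ξ / α) (σ * Real.sqrt (2 / ν) * (x - β)))) := by
  have ha := div_pos hξ hα
  have hG := Real.Gamma_pos_of_pos ha
  obtain ⟨a, haa⟩ : ∃ a, a = ξ / α := ⟨_, rfl⟩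
  have h2 : ξ / (2 * α) = a / 2 := by rw [haa]; field_simp
  rw [steadyClosedForm, neg_div α ξ, parabolicCylinder_neg ha, parabolicCylinder_neg ha, h2, ← haa]
  rw [← haa] at ha hG
  rw [show σ * β * Real.sqrt (2 / ν) = σ * Real.sqrt (2 / ν) * β by ring,
    show σ * (x - β) * Real.sqrt (2 / ν) = σ * Real.sqrt (2 / ν) * (x - β) by ring]
  -- Duplication at (1 + a)/2 together with Γ(a + 1) = a Γ(a) collapses the two Gamma factors of the
  -- closed form.
  have hdup := Real.Gamma_mul_Gamma_add_half (1 / 2 + a / 2)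
  rw [show 1 / 2 + a / 2 + 1 / 2 = 1 + a / 2 by ring, show 2 * (1 / 2 + a / 2) = a + 1 by ring,
    Real.Gamma_add_one ha.ne', show 1 - (a + 1) = -a by ring] at hdup
  have hpow : (2 : ℝ) ^ a * 2 ^ (-a) = 1 := by
    rw [← Real.rpow_add zero_lt_two, add_neg_cancel, Real.rpow_zero]
  have hconst : (2 : ℝ) ^ a / (Real.pi * Real.sqrt ν) * Real.Gamma (1 + a / 2) *
      Real.Gamma (1 / 2 + a / 2) = a * Real.Gamma a / Real.sqrt (Real.pi * ν) := by
    calc _ = (2 : ℝ) ^ a / (Real.pi * Real.sqrt ν) *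
          (Real.Gamma (1 / 2 + a / 2) * Real.Gamma (1 + a / 2)) := by ring
      _ = (2 : ℝ) ^ a * 2 ^ (-a) * (a * Real.Gamma a) *
          (Real.sqrt Real.pi / (Real.pi * Real.sqrt ν)) := by rw [hdup]; ring
      _ = _ := by
        have hpi : Real.sqrt Real.pi * Real.sqrt Real.pi = Real.pi :=
          Real.mul_self_sqrt Real.pi_pos.le
        have h3 : Real.sqrt Real.pi / (Real.pi * Real.sqrt ν) =
            1 / (Real.sqrt Real.pi * Real.sqrt ν) := by
          rw [div_eq_div_iff (by positivity) (by positivity)]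
          linear_combination Real.sqrt ν * hpi
        rw [hpow, Real.sqrt_mul Real.pi_pos.le, h3]
        ring
  have hs2 : Real.sqrt (2 / ν) ^ 2 = 2 / ν := Real.sq_sqrt (by positivity)
  -- Rests on x(x - 2β) + β² = (x - β)², the factors e^{-z²/4} of the two cylinder functions
  -- supplying β² and a second (x - β)².
  have hexp : Real.exp (-(x * (x - 2 * β)) / (2 * ν)) *
      Real.exp (-(σ * Real.sqrt (2 / ν) * β) ^ 2 / 4) *
      Real.exp (-(σ * Real.sqrt (2 / ν) * (x - β)) ^ 2 / 4) = Real.exp (-(x - β) ^ 2 / ν) := by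
    rw [← Real.exp_add, ← Real.exp_add]
    congr 1
    simp only [mul_pow, hσ, hs2]
    field_simp
    ring
  rw [hconst, ← hexp]
  field_simp

end

theorem mainTheorem5 (α β ν : ℝ) (hα : 0 < α) (hν : 0 < ν) :
    -- the Ornstein-Uhlenbeck process without resetting has the transition density `ouDensity`,
    -- which tends to `ouSteadyDensity`
    ((∀ (Ω : Type*) [mΩ : MeasurableSpace Ω] (P : Measure Ω) [IsProbabilityMeasure P]
        (ℱ : Filtration ℝ≥0 mΩ) (X : ℝ≥0 → Ω → ℝ) (y : ℝ), IsResetOU α β ν 0 y P ℱ X →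
        ∀ t : ℝ≥0, 0 < t → ∀ x : ℝ, HasDerivAt (distFun P X t) (ouDensity α β ν x t y) x) ∧
      (∀ x y : ℝ, Tendsto (fun t : ℝ => ouDensity α β ν x t y) atTop
        (𝓝 (ouSteadyDensity β ν x)))) ∧
    (∀ ξ : ℝ, 0 < ξ →
      -- the process with resetting has a transition density, which tends to `W`
      (∀ (Ω : Type*) [mΩ : MeasurableSpace Ω] (P : Measure Ω) [IsProbabilityMeasure P]
        (ℱ : Filtration ℝ≥0 mΩ) (X : ℝ≥0 → Ω → ℝ) (y : ℝ), IsResetOU α β ν ξ y P ℱ X →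
        (∀ t : ℝ≥0, 0 < t → ∀ x : ℝ, DifferentiableAt ℝ (distFun P X t) x) ∧
        ∀ x : ℝ, Tendsto (fun t : ℝ≥0 => transitionDensity P X x t) atTop
          (𝓝 (steadyDensity α β ν ξ x))) ∧
      -- the Laplace integral in `W` converges, and `W` is a probability density
      (∀ x : ℝ, IntegrableOn (fun t : ℝ => Real.exp (-ξ * t) * ouDensity α β ν x t 0)
        (Ioi 0)) ∧
      (∀ x : ℝ, 0 ≤ steadyDensity α β ν ξ x) ∧
      Integrable (steadyDensity α β ν ξ) ∧ ((∫ x : ℝ, steadyDensity α β ν ξ x) = 1) ∧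
      -- the closed form; at `x = 0` either sign may stand for `sgn x`
      (∀ x : ℝ, x ≠ 0 →
        steadyDensity α β ν ξ x = steadyClosedForm α β ν ξ (Real.sign x) x) ∧
      steadyDensity α β ν ξ 0 = steadyClosedForm α β ν ξ 1 0 ∧
      steadyDensity α β ν ξ 0 = steadyClosedForm α β ν ξ (-1) 0 ∧
      -- the symmetry
      (∀ x : ℝ, steadyDensity α β ν ξ x = steadyDensity α (-β) ν ξ (-x))) ∧
    -- the limit of vanishing resetting rate
    (∀ x : ℝ, Tendsto (fun ξ : ℝ => steadyDensity α β ν ξ x) (𝓝[>] 0)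
      (𝓝 (ouSteadyDensity β ν x))) := by
  refine ⟨⟨fun Ω mΩ P _ ℱ X y h t ht x => ?_, fun x y => tendsto_ouDensity hα hν x y⟩,
    fun ξ hξ => ⟨fun Ω mΩ P _ ℱ X y h => ⟨fun t ht x => ?_, fun x => ?_⟩, fun x => ?_,
      steadyDensity_nonneg hξ, integrable_steadyDensity hα hν hξ,
      integral_steadyDensity hα hν hξ, fun x hx => ?_, ?_, ?_, fun x => (steadyDensity_neg x).symm⟩,
    fun x => tendsto_steadyDensity hα hν x⟩
  -- At ξ = 0 the exponential factor is 1 and the mixture term drops out.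
  · simpa using h.hasDerivAt_distFun hα hν le_rfl ht x
  · exact (h.hasDerivAt_distFun hα hν hξ.le ht x).differentiableAt
  · refine (tendsto_resetDensity hα hν hξ x y).congr'
      ((eventually_gt_atTop 0).mono fun t ht => ?_)
    exact (h.hasDerivAt_distFun hα hν hξ.le ht x).deriv.symm
  · exact integrableOn_weight_mul_ouDensity hα hν le_rfl measurableSet_Ioi
      (integrableOn_weight_Ioi hξ) x
  · rw [← gluedDensity_eq_steadyDensity hα hν hξ, gluedDensity, gluedSolution]
    rcases lt_or_gt_of_ne hx with hx | hx
    · rw [Real.sign_of_neg hx, steadyClosedForm_eq hα hν hξ (by norm_num), if_neg (not_le.2 hx),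
        neg_one_mul]
    · rw [Real.sign_of_pos hx, steadyClosedForm_eq hα hν hξ (by norm_num), if_pos hx.le, one_mul]
  · rw [← gluedDensity_eq_steadyDensity hα hν hξ, gluedDensity, gluedSolution, if_pos le_rfl,
      steadyClosedForm_eq hα hν hξ (by norm_num), one_mul]
  · rw [← gluedDensity_eq_steadyDensity hα hν hξ, gluedDensity, gluedSolution, if_pos le_rfl,
      steadyClosedForm_eq hα hν hξ (by norm_num)]
    congr 2
    -- At x = 0 a change of sign merely swaps the two factors.
    rw [zero_sub, neg_one_mul, neg_mul_neg, neg_mul, mul_neg, mul_comm]
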